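/- Let $\sigma$ be a finite non-empty relational signature in which every relation symbol $R$ has an arity $\operatorname{ar}(R)\ge 1$. A $\sigma$-structure $A$ consists of a finite non-empty universe $V(A)$ and a relation $R^A\subseteq V(A)^{\operatorname{ar}(R)}$ for each $R\in\sigma$, such that every element of $V(A)$ occurs as an entry of at least one tuple of at least one relation. Let $\mathbf A=\bigcup_{R\in\sigma}R^A$ be the set of all its tuples, and for a tuple $a=(a_1,\dots,a_k)$ let $\operatorname{set}(a)=\{a_1,\dots,a_k\}$. Relational Color Refinement (RCR). For $a\in\mathbf A$ let $\operatorname{atp}(a)=\{R\in\sigma : a\in R^A\}$, and for $a,b\in\mathbf A$ let $\operatorname{stp}(a,b)=\{(i,j) : a_i=b_j\}$. Put $\varrho_0(a)=(\operatorname{atp}(a),\operatorname{stp}(a,a))$ and, for $i\ge 0$, $$\varrho_{i+1}(a)=\bigl(\varrho_i(a),\ \{\!\!\{(\operatorname{stp}(a,b),\varrho_i(b)) : b\in\mathbf A,\ \operatorname{stp}(a,b)\ne\emptyset\}\!\!\}\bigr),$$ where $\{\!\!\{\cdots\}\!\!\}$ denotes a multiset. RCR distinguishes $A$ and $B$ if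 there are a round $i\in\mathbb N$ and a color $c$ such that the number of $a\in\mathbf A$ with $\varrho_i(a)=c$ differs from the number of $b\in\mathbf B$ with $\varrho_i(b)=c$. A $\sigma$-structure $C$ is connected if its Gaifman graph is connected (the simple graph on $V(C)$ in which two distinct elements are adjacent iff they occur together in some tuple of $\mathbf C$). It is acyclic if it has a join-tree, i.e. a tree $J$ with vertex set $\mathbf C$ such that for every $x\in V(C)$ the set $\{c\in\mathbf C : x\in\operatorname{set}(c)\}$ induces a connected subgraph of $J$. A homomorphism from $C$ to $A$ is a map $h:V(C)\to V(A)$ such that $(c_1,\dots,c_k)\in R^C$ implies $(h(c_1),\dots,h(c_k))\in R^A$ for every $R\in\sigma$; let $\hom(C,A)$ be the number of homomorphisms. Theorem A. For all $\sigma$-structures $A$ and $B$ the following are equivalent: 1. RCR distinguishes $A$ and $B$. 2. There is an acyclic and connected $\sigma$-structure $C$ with $\hom(C,A)\ne\hom(C,B)$. -/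

import Mathlib

universe u v w w'

namespace RelColRef

open FirstOrder

/-- The tuples over `A` of arbitrary arity. -/
abbrev AnyTuple (A : Type w) : Type w := Σ n : ℕ, Fin n → A

/-- The set of entries of a tuple. -/
def entries {A : Type w} (a : AnyTuple A) : Set A := Set.range a.2

section

variable (L : FirstOrder.Language.{u, v}) (A : Type w) [L.Structure A]

/-- The set of all tuples that belong to some relation of the structure `A`. A tuple that belongs
to several relations (of the same arity) is one element of this set. -/
def tupleSet : Set (AnyTuple A) :=
  {a | ∃ R : L.Relations a.1, FirstOrder.Language.Structure.RelMap R a.2}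

/-- The tuples that belong to some relation of `A`, as a type. -/
abbrev Tuple : Type w := ↥(tupleSet L A)

/-- Every element of the universe is an entry of at least one tuple of at least one relation. -/
def EveryElementOccurs : Prop := ∀ x : A, ∃ a : Tuple L A, x ∈ entries a.1

/-- The Gaifman graph: two distinct elements are adjacent if some tuple contains both. -/
def gaifmanGraph : SimpleGraph A where
  Adj x y := x ≠ y ∧ ∃ a : Tuple L A, x ∈ entries a.1 ∧ y ∈ entries a.1
  symm := ⟨fun _ _ h => ⟨h.1.symm, h.2.imp fun _ ha => ⟨ha.2, ha.1⟩⟩⟩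
  loopless := ⟨fun _ h => h.1 rfl⟩

/-- A structure is connected if its Gaifman graph is connected. -/
def IsConnected : Prop := (gaifmanGraph L A).Connected

variable {L A} in
/-- A join-tree: a tree on the tuples of the structure in which, for every element `x` of the
universe, the tuples containing `x` induce a connected subgraph. -/
structure IsJoinTree (J : SimpleGraph (Tuple L A)) : Prop where
  isTree : J.IsTree
  connected : ∀ x : A, (J.induce {a : Tuple L A | x ∈ entries a.1}).Connected

/-- A structure is acyclic if it has a join-tree. -/
def IsAcyclic : Prop := ∃ J : SimpleGraph (Tuple L A), IsJoinTree J

/-- The number of homomorphisms from `C` to `A`. -/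
noncomputable def homCount (C A : Type*) [L.Structure C] [L.Structure A] : ℕ :=
  Nat.card (C →[L] A)

variable {A} in
/-- The atomic type of a tuple: the set of relation symbols whose relation contains it. -/
def atp (a : AnyTuple A) : Set (Σ n : ℕ, L.Relations n) :=
  {R | ∃ h : R.1 = a.1, FirstOrder.Language.Structure.RelMap R.2 (a.2 ∘ Fin.cast h)}

end

/-- The similarity type of two tuples: the set of pairs of positions (counted from `0`) at which
the two tuples have the same entry. -/
def stp {A : Type w} (a b : AnyTuple A) : Set (ℕ × ℕ) :=
  {p | ∃ (i : Fin a.1) (j : Fin b.1), p = ((i : ℕ), (j : ℕ)) ∧ a.2 i = b.2 j}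

/-- The possible colors of round `i`; they do not depend on a structure. -/
def Color (L : FirstOrder.Language.{u, v}) : ℕ → Type v
  | 0 => Set (Σ n : ℕ, L.Relations n) × Set (ℕ × ℕ)
  | i + 1 => Color L i × Multiset (Set (ℕ × ℕ) × Color L i)

section

variable (L : FirstOrder.Language.{u, v}) [Finite (Σ n : ℕ, L.Relations n)]

theorem finite_tuple (A : Type w) [L.Structure A] [Finite A] : Finite (Tuple L A) := by
  have : Finite (Σ R : (Σ n : ℕ, L.Relations n), Fin R.1 → A) := inferInstance
  refine Finite.of_injective
    (β := Σ R : (Σ n : ℕ, L.Relations n), Fin R.1 → A)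
    (fun a => ⟨⟨a.1.1, a.2.choose⟩, a.1.2⟩) ?_
  rintro ⟨⟨n, a⟩, ha⟩ ⟨⟨m, b⟩, hb⟩ h
  have hn : n = m := congrArg (fun s : (Σ R : (Σ n : ℕ, L.Relations n), Fin R.1 → A) => s.1.1) h
  subst hn
  have h2 := congrArg
    (fun s : (Σ R : (Σ n : ℕ, L.Relations n), Fin R.1 → A) => (⟨s.1.1, s.2⟩ : AnyTuple A)) h
  exact Subtype.ext h2

noncomputable instance (A : Type w) [L.Structure A] [Finite A] : Fintype (Tuple L A) :=
  haveI := finite_tuple L A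
  Fintype.ofFinite _

variable {A : Type w} [L.Structure A] [Finite A]

open Classical in
/-- Relational Color Refinement: the color of a tuple after `i` rounds. -/
noncomputable def color : (i : ℕ) → Tuple L A → Color L i
  | 0, a => (atp L a.1, stp a.1 a.1)
  | i + 1, a =>
    (color i a,
      ((Finset.univ.filter fun b : Tuple L A => (stp a.1 b.1).Nonempty).val.map
        fun b => (stp a.1 b.1, color i b)))

variable (A) in
/-- The number of tuples of `A` that have color `c` after `i` rounds. -/
noncomputable def colorCount (i : ℕ) (c : Color L i) : ℕ :=
  Nat.card {a : Tuple L A // color L i a = c}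

/-- Relational Color Refinement distinguishes `A` and `B` in round `i`. -/
def DistinguishesInRound (A B : Type*) [L.Structure A] [L.Structure B] [Finite A] [Finite B]
    (i : ℕ) : Prop :=
  ∃ c ∈ Set.range (color L (A := A) i) ∪ Set.range (color L (A := B) i),
    colorCount L A i c ≠ colorCount L B i c

/-- Relational Color Refinement distinguishes `A` and `B`. -/
def Distinguishes (A B : Type*) [L.Structure A] [L.Structure B] [Finite A] [Finite B] : Prop :=
  ∃ i : ℕ, DistinguishesInRound L A B i

end

end RelColRef

namespace RelColRef

open FirstOrder

/-! ### Weighted sums over tree-shaped constraint systems -/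

section TreeSum

/-! If RCR does not distinguish `A` and `B`, counting homomorphisms from an acyclic connected `C` is
message passing on a join-tree. A homomorphism is the same as an assignment of tuples of the target
to tuples of `C` that respects atomic and similarity types at each vertex and along each edge of the
tree (`homCount_eq_edgeSum`). The vertices are eliminated leaf by leaf: the sum over the values of a
leaf becomes a new factor in the weight of its neighbor. Initial weights depend only on round-0
colors, and elimination along an edge costs one round of refinement (`ColorInvariant.step`). That
step needs the two tuples at the edge to share an element, since RCR only looks at intersecting
tuples; connectedness of `C` guarantees this (`stp_nonempty_of_isJoinTree`). At the last vertex a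
function of colors is summed over all tuples, and equal color counts give equal sums.

For the converse, acyclic connected structures get a root tuple, and each such `P` yields the
function on the tuples of `A` and `B` that counts homomorphisms sending the root to a given tuple.
Let `W` be the rational span of these functions. Gluing roots makes `W` closed under products
(`mul_mem_countSpan`), so `W` contains the indicator of every set that is a union of classes of
tuples not separated by `W` (`indicator_mem`). Gluing the root of `Q` to the root of `P` along a set
`p` of position pairs multiplies the count of `P` by the sum of the counts of `Q` over all tuples
`b` with `p ⊆ stp a b`; hence unseparated tuples also agree on such sums of functions in `W`
(`Indistinguishable.sumAbove_eq`).

Induction on the round then shows that unseparated tuples have equal colors. By the induction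
hypothesis the indicators of round-`i` colors lie in `W`, so for every nonempty `q` and every color
`k` the number of `b` of color `k` with `q ⊆ stp a b` is determined. Inversion over inclusion
(`count_eq_of_countP_le_eq`) recovers the numbers with `stp a b = q`, which is what the next color
records. Finally, summing a generator of `W` over all tuples of a structure gives a homomorphism
count. If all these counts agreed on `A` and `B`, the indicators of the color classes would have
equal sums, and RCR would not distinguish. -/

open Classical in
/-- The weighted number of maps from the vertices of a graph to `X` that satisfy a binary
constraint along every edge. -/
noncomputable def edgeSum {V X : Type*} [Fintype V] [Fintype X] (G : SimpleGraph V)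
    (W : V → X → ℕ) (E : V → V → X → X → Prop) : ℕ :=
  ∑ φ : V → X, if ∀ u v, G.Adj u v → E u v (φ u) (φ v) then ∏ v, W v (φ v) else 0

open Classical in
/-- A leaf of a graph can be eliminated from `edgeSum` by changing the weight of its neighbor. -/
theorem edgeSum_eq_of_leaf {V X : Type*} [Fintype V] [Fintype X] (G : SimpleGraph V)
    (W : V → X → ℕ) (E : V → V → X → X → Prop)
    (hE : ∀ u v a b, E u v a b → E v u b a) (l p : V) (hp : ∀ u, G.Adj l u ↔ u = p) :
    edgeSum G W E = edgeSum (G.induce {l}ᶜ)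
      (fun u a => W u a * if (u : V) = p then ∑ b, if E p l a b then W l b else 0 else 1)
      (fun u v => E u v) := by
  have hlp : p ≠ l := ((hp p).2 rfl).ne'
  unfold edgeSum
  -- An assignment is split into its value at the leaf `l` and its restriction `ψ` to the other
  -- vertices; the identity is then proved for each `ψ` separately.
  rw [← (Equiv.funSplitAt l X).symm.sum_comp, Fintype.sum_prod_type_right]
  refine Finset.sum_congr
    (congrArg (@Finset.univ _) (Subsingleton.elim _ _)) fun ψ _ => ?_
  have hψ : ∀ (x : X) (j : V) (hj : j ≠ l),
      (Equiv.funSplitAt l X).symm (x, ψ) j = ψ ⟨j, hj⟩ := by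
    intro x j hj; simp [Equiv.funSplitAt, Equiv.piSplitAt, hj]
  have hl : ∀ x : X, (Equiv.funSplitAt l X).symm (x, ψ) l = x := by
    intro x; simp [Equiv.funSplitAt, Equiv.piSplitAt]
  have hcond : ∀ x : X, (∀ u v, G.Adj u v → E u v ((Equiv.funSplitAt l X).symm (x, ψ) u)
      ((Equiv.funSplitAt l X).symm (x, ψ) v)) ↔
      (E p l (ψ ⟨p, hlp⟩) x ∧ ∀ u v : ({l}ᶜ : Set V), (G.induce {l}ᶜ).Adj u v →
        E u v (ψ u) (ψ v)) := by
    intro x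
    constructor
    · intro h
      refine ⟨?_, fun u v huv => ?_⟩
      · have := h p l ((hp p).2 rfl).symm
        rwa [hψ x p hlp, hl] at this
      · have := h u v huv
        rwa [hψ x u u.2, hψ x v v.2] at this
    · rintro ⟨h1, h2⟩ u v huv
      by_cases hu : u = l
      · subst hu
        obtain rfl := (hp v).1 huv
        rw [hψ x v hlp, hl]
        exact hE _ _ _ _ h1
      · by_cases hv : v = l
        · subst hv
          obtain rfl := (hp u).1 huv.symm
          rw [hψ x u hlp, hl]
          exact h1
        · rw [hψ x u hu, hψ x v hv]
          exact h2 ⟨u, hu⟩ ⟨v, hv⟩ huv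
  have hprod : ∀ x : X, ∏ v, W v ((Equiv.funSplitAt l X).symm (x, ψ) v) =
      W l x * ∏ v : ({l}ᶜ : Set V), W v (ψ v) := by
    intro x
    rw [Fintype.prod_eq_mul_prod_subtype_ne _ l, hl]
    congr 1
    refine Fintype.prod_congr _ _ fun j => ?_
    rw [hψ x j j.2]
  simp only [hcond, hprod]
  by_cases h : ∀ u v : ({l}ᶜ : Set V), (G.induce {l}ᶜ).Adj u v → E u v (ψ u) (ψ v)
  · have h3 : (∏ v : ({l}ᶜ : Set V),
        if (v : V) = p then ∑ b, if E p l (ψ v) b then W l b else 0 else 1) =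
        ∑ b, if E p l (ψ ⟨p, hlp⟩) b then W l b else 0 := by
      rw [Finset.prod_eq_single (⟨p, hlp⟩ : ({l}ᶜ : Set V))]
      · exact if_pos rfl
      · intro b _ hb
        rw [if_neg fun hbp => hb (Subtype.ext hbp)]
      · exact fun h' => absurd (Finset.mem_univ _) h'
    rw [if_pos h, Finset.prod_mul_distrib, h3, mul_comm, Finset.sum_mul]
    refine Finset.sum_congr rfl fun x _ => ?_
    by_cases hx : E p l (ψ ⟨p, hlp⟩) x
    · rw [if_pos ⟨hx, h⟩, if_pos hx]
    · rw [if_neg fun h' => hx h'.1, if_neg hx, zero_mul]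
  · rw [if_neg h]
    exact Finset.sum_eq_zero fun x _ => if_neg fun hx => h hx.2

open Classical in
/-- Two families of weights on a tree have the same `edgeSum` if they are related by a relation
that is preserved by products and by summation along edges, and that implies equal sums. -/
theorem edgeSum_eq_of_isTree {X Y : Type*} [Fintype X] [Fintype Y]
    (Inv : (X → ℕ) → (Y → ℕ) → Prop)
    (hmul : ∀ f g f' g', Inv f g → Inv f' g' → Inv (fun a => f a * f' a) fun a => g a * g' a)
    (hsum : ∀ f g, Inv f g → ∑ a, f a = ∑ a, g a)
    {V : Type*} [Fintype V] (G : SimpleGraph V) (hG : G.IsTree)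
    (E : V → V → X → X → Prop) (E' : V → V → Y → Y → Prop)
    (hE : ∀ u v a b, E u v a b → E v u b a) (hE' : ∀ u v a b, E' u v a b → E' v u b a)
    (hstep : ∀ u v, G.Adj u v → ∀ f g, Inv f g →
      Inv (fun a => ∑ b, if E u v a b then f b else 0)
        fun a => ∑ b, if E' u v a b then g b else 0)
    (W : V → X → ℕ) (W' : V → Y → ℕ) (hW : ∀ v, Inv (W v) (W' v)) :
    edgeSum G W E = edgeSum G W' E' := by
  induction hn : Fintype.card V using Nat.strong_induction_on generalizing V with
  | _ n ih =>
    subst hn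
    obtain hV | hV := subsingleton_or_nontrivial V
    · obtain ⟨v⟩ := hG.connected.nonempty
      have : Unique V := ⟨⟨v⟩, fun _ => Subsingleton.elim _ _⟩
      have hadj : ∀ u v, ¬ G.Adj u v := fun u v h => h.ne (Subsingleton.elim _ _)
      unfold edgeSum
      simp only [hadj, false_imp_iff, implies_true, if_true, Fintype.prod_unique]
      have e1 := (Equiv.funUnique V X).sum_comp (W default)
      have e2 := (Equiv.funUnique V Y).sum_comp (W' default)
      simp only [Equiv.funUnique_apply] at e1 e2
      rw [e1, e2]
      exact hsum _ _ (hW _)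
    · obtain ⟨l, hl⟩ := hG.exists_vert_degree_one_of_nontrivial
      obtain ⟨p, hp, hpu⟩ := G.degree_eq_one_iff_existsUnique_adj.1 hl
      have hadj : ∀ u, G.Adj l u ↔ u = p := fun u => ⟨hpu u, fun h => h ▸ hp⟩
      rw [edgeSum_eq_of_leaf G W E hE l p hadj, edgeSum_eq_of_leaf G W' E' hE' l p hadj]
      refine ih _ ?_ (G.induce {l}ᶜ)
        ⟨hG.connected.induce_compl_singleton_of_degree_eq_one hl, hG.isAcyclic.induce _⟩
        _ _ (fun u v => hE u v) (fun u v => hE' u v) (fun u v h => hstep u v h) _ _ ?_ rfl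
      · exact Fintype.card_subtype_lt (x := l) (by simp)
      · intro u
        by_cases hu : (u : V) = p
        · simp only [hu, if_true]
          exact hmul _ _ _ _ (hW _) (hstep _ _ hp.symm _ _ (hW _))
        · simp only [hu, if_false, mul_one]
          exact hW u

end TreeSum

/-! ### Similarity types, atomic types and images of tuples -/

section Tuples

theorem mem_stp_iff {A : Type*} {a b : AnyTuple A} {i j : ℕ} :
    (i, j) ∈ stp a b ↔ ∃ (hi : i < a.1) (hj : j < b.1), a.2 ⟨i, hi⟩ = b.2 ⟨j, hj⟩ := by
  constructor
  · rintro ⟨i', j', h, hab⟩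
    obtain ⟨rfl, rfl⟩ := Prod.mk.inj h
    exact ⟨i'.2, j'.2, hab⟩
  · rintro ⟨hi, hj, h⟩
    exact ⟨⟨i, hi⟩, ⟨j, hj⟩, rfl, h⟩

theorem mk_mem_stp {A : Type*} {a b : AnyTuple A} {i : Fin a.1} {j : Fin b.1} :
    ((i : ℕ), (j : ℕ)) ∈ stp a b ↔ a.2 i = b.2 j := by
  rw [mem_stp_iff]
  exact ⟨fun ⟨_, _, h⟩ => h, fun h => ⟨i.2, j.2, h⟩⟩

theorem stp_symm {A : Type*} {a b : AnyTuple A} {i j : ℕ} (h : (i, j) ∈ stp a b) :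
    (j, i) ∈ stp b a := by
  rw [mem_stp_iff] at h ⊢
  obtain ⟨hi, hj, h⟩ := h
  exact ⟨hj, hi, h.symm⟩

theorem stp_trans {A : Type*} {a b c : AnyTuple A} {i j k : ℕ} (h : (i, j) ∈ stp a b)
    (h' : (j, k) ∈ stp b c) : (i, k) ∈ stp a c := by
  rw [mem_stp_iff] at h h' ⊢
  obtain ⟨hi, hj, h⟩ := h
  obtain ⟨_, hk, h'⟩ := h'
  exact ⟨hi, hk, h.trans h'⟩

theorem stp_subset_symm {A A' : Type*} {a b : AnyTuple A} {a' b' : AnyTuple A'}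
    (h : stp a b ⊆ stp a' b') : stp b a ⊆ stp b' a' :=
  fun _ hx => stp_symm (h (stp_symm hx))

theorem stp_nonempty_iff {A : Type*} {a b : AnyTuple A} :
    (stp a b).Nonempty ↔ (entries a ∩ entries b).Nonempty := by
  constructor
  · rintro ⟨_, i, j, rfl, h⟩
    exact ⟨a.2 i, ⟨i, rfl⟩, ⟨j, h.symm⟩⟩
  · rintro ⟨_, ⟨i, rfl⟩, ⟨j, h⟩⟩
    exact ⟨_, i, j, rfl, h.symm⟩

theorem anyTuple_ext {A : Type*} {a b : AnyTuple A} (h : a.1 = b.1)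
    (h' : ∀ (i : ℕ) (hi : i < a.1) (hj : i < b.1), a.2 ⟨i, hi⟩ = b.2 ⟨i, hj⟩) : a = b := by
  obtain ⟨n, a⟩ := a
  obtain ⟨m, b⟩ := b
  obtain rfl : n = m := h
  congr 1
  ext i
  exact h' i i.2 i.2

variable {L : FirstOrder.Language.{u, v}}

theorem mk_mem_atp {A : Type*} [L.Structure A] {n : ℕ} {R : L.Relations n} {a : Fin n → A} :
    (⟨n, R⟩ : Σ n, L.Relations n) ∈ atp L ⟨n, a⟩ ↔ FirstOrder.Language.Structure.RelMap R a :=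
  ⟨fun ⟨_, h⟩ => h, fun h => ⟨rfl, h⟩⟩

theorem mem_atp_iff {A : Type*} [L.Structure A] {a : AnyTuple A} {R : L.Relations a.1} :
    (⟨a.1, R⟩ : Σ n, L.Relations n) ∈ atp L a ↔ FirstOrder.Language.Structure.RelMap R a.2 :=
  ⟨fun ⟨_, h⟩ => h, fun h => ⟨rfl, h⟩⟩

theorem arity_pos (hpos : IsEmpty (L.Relations 0)) {A : Type*} [L.Structure A] (a : Tuple L A) :
    0 < a.1.1 := by
  obtain ⟨⟨n, a⟩, R, _⟩ := a
  refine Nat.pos_of_ne_zero fun h => ?_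
  obtain rfl : n = 0 := h
  exact hpos.false R

theorem arity_eq_of_atp_subset {A B : Type*} [L.Structure A] [L.Structure B] {a : Tuple L A}
    {b : AnyTuple B} (h : atp L a.1 ⊆ atp L b) : a.1.1 = b.1 := by
  obtain ⟨R, hR⟩ := a.2
  exact (h (mem_atp_iff.2 hR)).1

/-- The image of a tuple under a map. -/
def mapTuple {A B : Type*} (h : A → B) (a : AnyTuple A) : AnyTuple B := ⟨a.1, h ∘ a.2⟩

theorem stp_subset_stp_mapTuple {A B : Type*} (h : A → B) (a b : AnyTuple A) :
    stp a b ⊆ stp (mapTuple h a) (mapTuple h b) := by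
  rintro _ ⟨i, j, rfl, hij⟩
  exact ⟨i, j, rfl, congrArg h hij⟩

theorem atp_subset_atp_mapTuple {A B : Type*} [L.Structure A] [L.Structure B] (h : A →[L] B)
    (a : AnyTuple A) : atp L a ⊆ atp L (mapTuple h a) := by
  rintro R ⟨hR, hRa⟩
  exact ⟨hR, h.map_rel _ _ hRa⟩

/-- The image of a tuple of a structure under a homomorphism. -/
def homTuple {A B : Type*} [L.Structure A] [L.Structure B] (h : A →[L] B) (a : Tuple L A) :
    Tuple L B :=
  ⟨mapTuple h a.1, a.2.choose, h.map_rel _ _ a.2.choose_spec⟩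

theorem finite_hom (A B : Type*) [L.Structure A] [L.Structure B] [Finite A] [Finite B] :
    Finite (A →[L] B) :=
  Finite.of_injective (fun h : A →[L] B => (h : A → B)) DFunLike.coe_injective

end Tuples

/-! ### Homomorphisms as assignments along a join-tree -/

section JoinTree

variable {L : FirstOrder.Language.{u, v}} {A C : Type*} [L.Structure A] [L.Structure C]

/-- Local consistency implies global consistency: two tuples sharing `x` are joined by a walk in the
tree on which every tuple contains `x`, and the equalities along its edges compose. The hypothesis
`h1` handles repeated entries within one tuple, where the walk is trivial. -/
theorem stp_subset_of_isJoinTree {J : SimpleGraph (Tuple L C)} (hJ : IsJoinTree J)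
    (φ : Tuple L C → Tuple L A) (h1 : ∀ c, stp c.1 c.1 ⊆ stp (φ c).1 (φ c).1)
    (h2 : ∀ c d, J.Adj c d → stp c.1 d.1 ⊆ stp (φ c).1 (φ d).1) (c d : Tuple L C) :
    stp c.1 d.1 ⊆ stp (φ c).1 (φ d).1 := by
  rintro _ ⟨i, j, rfl, hij⟩
  obtain ⟨x, hx⟩ : ∃ x, c.1.2 i = x := ⟨_, rfl⟩
  have hx' : d.1.2 j = x := hij.symm.trans hx
  obtain ⟨p⟩ := (hJ.connected x).preconnected ⟨c, i, hx⟩ ⟨d, j, hx'⟩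
  have key : ∀ (e f : {a : Tuple L C | x ∈ entries a.1})
      (_ : (J.induce {a : Tuple L C | x ∈ entries a.1}).Walk e f)
      (k : Fin e.1.1.1) (l : Fin f.1.1.1), e.1.1.2 k = x → f.1.1.2 l = x →
      ((k : ℕ), (l : ℕ)) ∈ stp (φ e.1).1 (φ f.1).1 := by
    intro e f q
    induction q with
    | nil =>
      intro k l hk hl
      exact h1 _ (mk_mem_stp.2 (hk.trans hl.symm))
    | cons hadj q ih =>
      rename_i e f g
      intro k l hk hl
      obtain ⟨m, hm⟩ := f.2
      exact stp_trans (h2 _ _ hadj (mk_mem_stp.2 (hk.trans hm.symm))) (ih m l hm hl)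
  exact key _ _ p i j hx hx'

/-- The value at `x` is read off from the image of some tuple containing `x`; `h2` makes it
independent of the chosen tuple and position. -/
theorem exists_hom_of_stp_subset [L.IsRelational] (hC : EveryElementOccurs L C)
    (φ : Tuple L C → Tuple L A) (h1 : ∀ c, atp L c.1 ⊆ atp L (φ c).1)
    (h2 : ∀ c d, stp c.1 d.1 ⊆ stp (φ c).1 (φ d).1) :
    ∃ h : C →[L] A, homTuple h = φ := by
  choose t ht using hC
  choose k hk using ht
  have hlen : ∀ c, c.1.1 = (φ c).1.1 := fun c => arity_eq_of_atp_subset (h1 c)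
  let h : C → A := fun x => (φ (t x)).1.2 (Fin.cast (hlen _) (k x))
  have hh : ∀ c, mapTuple h c.1 = (φ c).1 := by
    intro c
    refine anyTuple_ext (hlen c) fun i hi hj => ?_
    have : ((i : ℕ), ((k (c.1.2 ⟨i, hi⟩) : Fin _) : ℕ)) ∈ stp c.1 (t (c.1.2 ⟨i, hi⟩)).1 :=
      mem_stp_iff.2 ⟨hi, Fin.is_lt _, (hk _).symm⟩
    obtain ⟨_, _, h3⟩ := mem_stp_iff.1 (h2 _ _ this)
    exact h3.symm
  refine ⟨⟨h, fun f => isEmptyElim f, fun {n} R x hx => ?_⟩, ?_⟩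
  · have h3 := h1 ⟨⟨n, x⟩, R, hx⟩ (mk_mem_atp.2 hx)
    rw [← hh] at h3
    exact mk_mem_atp.1 h3
  · funext c
    exact Subtype.ext (hh c)

theorem homTuple_injective (hC : EveryElementOccurs L C) :
    Function.Injective (homTuple : (C →[L] A) → Tuple L C → Tuple L A) := by
  intro h h' hh
  ext x
  obtain ⟨c, i, rfl⟩ := hC x
  have h3 := congrArg Subtype.val (congrFun hh c)
  exact congrFun (eq_of_heq (Sigma.mk.inj h3).2) i

/-- In a connected structure, adjacent tuples of a join-tree share an element. -/
theorem stp_nonempty_of_isJoinTree (hpos : IsEmpty (L.Relations 0)) (hconn : IsConnected L C)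
    {J : SimpleGraph (Tuple L C)} (hJ : IsJoinTree J) {c d : Tuple L C} (hcd : J.Adj c d) :
    (stp c.1 d.1).Nonempty := by
  by_contra hne
  rw [stp_nonempty_iff] at hne
  -- In a tree every edge is a bridge. If `c` and `d` were disjoint, the Gaifman graph would provide
  -- a detour around this edge.
  have hbr : ¬ (J.deleteEdges {s(c, d)}).Reachable c d :=
    SimpleGraph.isBridge_iff.1 (SimpleGraph.isAcyclic_iff_forall_adj_isBridge.1 hJ.isTree.isAcyclic hcd)
  -- A walk among tuples containing `x` cannot use the edge from `c` to `d`, since these would then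
  -- both contain `x`.
  have hbag : ∀ x (e f : {a : Tuple L C | x ∈ entries a.1}),
      (J.deleteEdges {s(c, d)}).Reachable e.1 f.1 := by
    intro x e f
    obtain ⟨p⟩ := (hJ.connected x).preconnected e f
    induction p with
    | nil => rfl
    | cons hadj q ih =>
      rename_i e f g
      refine SimpleGraph.Reachable.trans (SimpleGraph.Adj.reachable ?_) ih
      rw [SimpleGraph.deleteEdges_adj]
      refine ⟨hadj, fun h => hne ?_⟩
      rw [Set.mem_singleton_iff, Sym2.eq_iff] at h
      obtain ⟨h, h'⟩ | ⟨h, h'⟩ := h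
      · exact ⟨x, h ▸ e.2, h' ▸ f.2⟩
      · exact ⟨x, h' ▸ f.2, h ▸ e.2⟩
  have hside : ∀ x y, (gaifmanGraph L C).Reachable x y →
      ∀ e f : Tuple L C, x ∈ entries e.1 → y ∈ entries f.1 →
      (J.deleteEdges {s(c, d)}).Reachable e f := by
    rintro x y ⟨p⟩
    induction p with
    | nil => exact fun e f he hf => hbag _ ⟨e, he⟩ ⟨f, hf⟩
    | cons hadj q ih =>
      intro e f he hf
      obtain ⟨_, g, hg, hg'⟩ := hadj
      exact (hbag _ ⟨e, he⟩ ⟨g, hg⟩).trans (ih g f hg' hf)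
  exact hbr (hside _ _ (hconn.preconnected (c.1.2 ⟨0, arity_pos hpos c⟩)
    (d.1.2 ⟨0, arity_pos hpos d⟩)) c d ⟨_, rfl⟩ ⟨_, rfl⟩)

variable [Finite (Σ n : ℕ, L.Relations n)] [Finite A] [Finite C]

open Classical in
/-- Homomorphisms are counted by the constraint sum along a join-tree. -/
theorem homCount_eq_edgeSum [L.IsRelational] (hC : EveryElementOccurs L C)
    {J : SimpleGraph (Tuple L C)} (hJ : IsJoinTree J) :
    homCount L C A = edgeSum J
      (fun c (a : Tuple L A) => if atp L c.1 ⊆ atp L a.1 ∧ stp c.1 c.1 ⊆ stp a.1 a.1 then 1 else 0)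
      (fun c d a b => stp c.1 d.1 ⊆ stp a.1 b.1) := by
  have hcard : homCount L C A = Nat.card {φ : Tuple L C → Tuple L A //
      (∀ c d, J.Adj c d → stp c.1 d.1 ⊆ stp (φ c).1 (φ d).1) ∧
      ∀ c, atp L c.1 ⊆ atp L (φ c).1 ∧ stp c.1 c.1 ⊆ stp (φ c).1 (φ c).1} := by
    refine Nat.card_congr (Equiv.ofBijective
      (fun h => ⟨homTuple h, fun c d _ => stp_subset_stp_mapTuple _ _ _,
        fun c => ⟨atp_subset_atp_mapTuple _ _, stp_subset_stp_mapTuple _ _ _⟩⟩)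
      ⟨fun h h' hh => homTuple_injective hC (congrArg Subtype.val hh), ?_⟩)
    rintro ⟨φ, h1, h2⟩
    obtain ⟨h, rfl⟩ := exists_hom_of_stp_subset hC φ (fun c => (h2 c).1)
      (stp_subset_of_isJoinTree hJ φ (fun c => (h2 c).2) h1)
    exact ⟨h, rfl⟩
  rw [hcard, Nat.card_eq_fintype_card, Fintype.card_subtype, Finset.card_filter, edgeSum]
  refine Finset.sum_congr (congrArg (@Finset.univ _) (Subsingleton.elim _ _)) fun φ _ => ?_
  rw [Finset.prod_ite_zero, Finset.prod_const_one, ite_and]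
  simp only [Finset.mem_univ, forall_true_left]

end JoinTree

/-! ### Equal colors give equal homomorphism counts -/

section ColorInvariant

variable (L : FirstOrder.Language.{u, v}) [Finite (Σ n : ℕ, L.Relations n)]

/-- A color contains its predecessor as first component, so `r` iterates the projection. Both
universes occur in one statement so that the same `r` serves `A` and `B`. -/
theorem exists_color_factor {i j : ℕ} (hij : i ≤ j) :
    ∃ r : Color L j → Color L i,
      (∀ (A : Type w) [L.Structure A] [Finite A] (a : Tuple L A), r (color L j a) = color L i a) ∧
      ∀ (A : Type w') [L.Structure A] [Finite A] (a : Tuple L A), r (color L j a) = color L i a := by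
  induction j, hij using Nat.le_induction with
  | base => exact ⟨id, fun _ _ _ _ => rfl, fun _ _ _ _ => rfl⟩
  | succ j _ ih =>
    obtain ⟨r, hr, hr'⟩ := ih
    exact ⟨fun c => r c.1, fun A _ _ a => hr A a, fun A _ _ a => hr' A a⟩


/-- Two functions on the tuples of two structures that are given by the same function of the
colors of some round. -/
def ColorInvariant {A : Type w} {B : Type w'} [L.Structure A] [L.Structure B] [Finite A] [Finite B]
    (f : Tuple L A → ℕ) (g : Tuple L B → ℕ) : Prop :=
  ∃ (i : ℕ) (F : Color L i → ℕ), (∀ a, f a = F (color L i a)) ∧ ∀ b, g b = F (color L i b)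

variable {L} {A : Type w} {B : Type w'} [L.Structure A] [L.Structure B] [Finite A] [Finite B]

theorem ColorInvariant.mul {f f' : Tuple L A → ℕ} {g g' : Tuple L B → ℕ}
    (h : ColorInvariant L f g) (h' : ColorInvariant L f' g') :
    ColorInvariant L (fun a => f a * f' a) fun a => g a * g' a := by
  obtain ⟨i, F, hf, hg⟩ := h
  obtain ⟨j, F', hf', hg'⟩ := h'
  obtain ⟨r, hrA, hrB⟩ := exists_color_factor.{u, v, w, w'} L (le_max_left i j)
  obtain ⟨r', hrA', hrB'⟩ := exists_color_factor.{u, v, w, w'} L (le_max_right i j)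
  refine ⟨max i j, fun c => F (r c) * F' (r' c), fun a => ?_, fun b => ?_⟩
  · simp only [hf, hf', hrA, hrA']
  · simp only [hg, hg', hrB, hrB']

open Classical in
-- The color of round `i + 1` lists the similarity types and round-`i` colors of all intersecting
-- tuples, so the sum can be read off from it. Tuples missing from the list contribute zero because
-- `q` is nonempty.
theorem ColorInvariant.step {f : Tuple L A → ℕ} {g : Tuple L B → ℕ} (h : ColorInvariant L f g)
    {q : Set (ℕ × ℕ)} (hq : q.Nonempty) :
    ColorInvariant L (fun a => ∑ b : Tuple L A, if q ⊆ stp a.1 b.1 then f b else 0)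
      fun a => ∑ b : Tuple L B, if q ⊆ stp a.1 b.1 then g b else 0 := by
  obtain ⟨i, F, hf, hg⟩ := h
  refine ⟨i + 1, fun c => (c.2.map fun s => if q ⊆ s.1 then F s.2 else 0).sum, ?_, ?_⟩
  all_goals
    intro a
    simp only [color, Multiset.map_map, Function.comp_apply, hf, hg]
    refine (Finset.sum_filter_of_ne fun b _ hb => ?_).symm
    exact hq.mono (by_contra fun hab => hb (if_neg hab))

open Classical in
-- Distinguishing only compares colors that occur in `A` or `B`; all other colors have multiplicity
-- zero on both sides.
theorem map_color_eq (h : ¬ Distinguishes L A B) (i : ℕ) :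
    (Finset.univ : Finset (Tuple L A)).val.map (color L i) =
      (Finset.univ : Finset (Tuple L B)).val.map (color L i) := by
  ext c
  by_cases hc : c ∈ Set.range (color L (A := A) i) ∪ Set.range (color L (A := B) i)
  · have h1 : colorCount L A i c = colorCount L B i c :=
      by_contra fun hne => h ⟨i, c, hc, hne⟩
    rw [colorCount, colorCount, Nat.card_eq_fintype_card, Nat.card_eq_fintype_card,
      Fintype.card_subtype, Fintype.card_subtype] at h1
    rw [Multiset.count_map, Multiset.count_map]
    simp only [eq_comm (a := c)]
    exact h1
  · rw [Multiset.count_eq_zero_of_notMem, Multiset.count_eq_zero_of_notMem]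
    · rintro hm
      obtain ⟨b, _, hb⟩ := Multiset.mem_map.1 hm
      exact hc (Or.inr ⟨b, hb⟩)
    · rintro hm
      obtain ⟨b, _, hb⟩ := Multiset.mem_map.1 hm
      exact hc (Or.inl ⟨b, hb⟩)

theorem ColorInvariant.sum_eq (h : ¬ Distinguishes L A B) {f : Tuple L A → ℕ} {g : Tuple L B → ℕ}
    (hfg : ColorInvariant L f g) : ∑ a, f a = ∑ b, g b := by
  obtain ⟨i, F, hf, hg⟩ := hfg
  have h1 := congrArg (fun m => (m.map F).sum) (map_color_eq h i)
  simp only [Multiset.map_map, Function.comp_def] at h1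
  simp only [hf, hg]
  exact h1

/-- Homomorphism counts from connected acyclic structures do not separate structures that
Relational Color Refinement does not distinguish. -/
theorem homCount_eq_of_not_distinguishes [L.IsRelational] (hpos : IsEmpty (L.Relations 0))
    (h : ¬ Distinguishes L A B) {C : Type*} [L.Structure C] [Finite C]
    (hC : EveryElementOccurs L C) (hacyc : IsAcyclic L C) (hconn : IsConnected L C) :
    homCount L C A = homCount L C B := by
  classical
  obtain ⟨J, hJ⟩ := hacyc
  rw [homCount_eq_edgeSum hC hJ, homCount_eq_edgeSum hC hJ]
  refine edgeSum_eq_of_isTree (ColorInvariant L) (fun f g f' g' hfg hfg' => hfg.mul hfg')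
    (fun f g hfg => hfg.sum_eq h) J hJ.isTree _ _ (fun _ _ _ _ => stp_subset_symm)
    (fun _ _ _ _ => stp_subset_symm) ?_ _ _ ?_
  · intro c d hcd f g hfg
    exact hfg.step (stp_nonempty_of_isJoinTree hpos hconn hJ hcd)
  · intro c
    -- The constraint at a single vertex only reads the atomic type and the self-similarity type,
    -- which form the round-0 color.
    exact ⟨0, fun s => if atp L c.1 ⊆ s.1 ∧ stp c.1 c.1 ⊆ s.2 then 1 else 0,
      fun a => rfl, fun b => rfl⟩

end ColorInvariant

/-! ### Inductive construction of acyclic connected tuple sets -/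

section RootedAcyclic

/-- A set of tuples is acyclic with root `c` if it arises from `{c}` by successively adding tuples
that meet a tuple `p` of the set and share with the whole set only entries of `p`. -/
inductive RootedAcyclic {X : Type*} (c : AnyTuple X) : Set (AnyTuple X) → Prop
  | root : RootedAcyclic c {c}
  | step (S : Set (AnyTuple X)) (t p : AnyTuple X) (hS : RootedAcyclic c S) (hp : p ∈ S)
      (hmeet : (entries t ∩ entries p).Nonempty)
      (hinter : ∀ x ∈ entries t, ∀ s ∈ S, x ∈ entries s → x ∈ entries p) :
      RootedAcyclic c (insert t S)

variable {X Y : Type*} {c : AnyTuple X} {S : Set (AnyTuple X)}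

theorem RootedAcyclic.root_mem (h : RootedAcyclic c S) : c ∈ S := by
  induction h with
  | root => rfl
  | step S t p _ _ _ _ ih => exact Or.inr ih

theorem entries_mapTuple (f : X → Y) (a : AnyTuple X) : entries (mapTuple f a) = f '' entries a :=
  Set.range_comp f a.2

theorem RootedAcyclic.image (h : RootedAcyclic c S) {f : X → Y} (hf : Function.Injective f) :
    RootedAcyclic (mapTuple f c) (mapTuple f '' S) := by
  induction h with
  | root => rw [Set.image_singleton]; exact .root
  | step S t p _ hp hmeet hinter ih =>
    rw [Set.image_insert_eq]
    refine .step _ _ _ ih ⟨p, hp, rfl⟩ ?_ ?_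
    · rw [entries_mapTuple, entries_mapTuple]
      obtain ⟨x, hx, hx'⟩ := hmeet
      exact ⟨f x, ⟨x, hx, rfl⟩, ⟨x, hx', rfl⟩⟩
    · simp only [entries_mapTuple]
      rintro _ ⟨x, hx, rfl⟩ _ ⟨s, hs, rfl⟩ hxs
      rw [entries_mapTuple] at hxs
      obtain ⟨y, hy, hyx⟩ := hxs
      obtain rfl := hf hyx
      exact ⟨y, hinter y hx s hs hy, rfl⟩

/-- Two acyclic sets can be joined by an edge between their roots, where the map `f` may identify
entries of the second root. -/
theorem RootedAcyclic.union_image (h : RootedAcyclic c S) {d : AnyTuple Y} {T : Set (AnyTuple Y)}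
    (h' : RootedAcyclic d T) (f : Y → X)
    (hmeet : (entries (mapTuple f d) ∩ entries c).Nonempty)
    (hS : ∀ y, ∀ s ∈ S, f y ∈ entries s → y ∈ entries d ∧ f y ∈ entries c)
    (hf : ∀ y y', f y = f y' → y = y' ∨ y ∈ entries d ∧ y' ∈ entries d) :
    RootedAcyclic c (S ∪ mapTuple f '' T) := by
  induction h' with
  | root =>
    rw [Set.image_singleton, Set.union_singleton]
    refine .step _ _ _ h h.root_mem hmeet ?_
    rw [entries_mapTuple]
    rintro _ ⟨y, _, rfl⟩ s hs hys
    exact (hS y s hs hys).2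
  | step T t p hT hp hmeet' hinter ih =>
    rw [Set.image_insert_eq, Set.union_insert]
    refine .step _ _ _ ih (Or.inr ⟨p, hp, rfl⟩) ?_ ?_
    · rw [entries_mapTuple, entries_mapTuple]
      obtain ⟨x, hx, hx'⟩ := hmeet'
      exact ⟨f x, ⟨x, hx, rfl⟩, ⟨x, hx', rfl⟩⟩
    · simp only [entries_mapTuple]
      rintro _ ⟨y, hy, rfl⟩ s (hs | ⟨s, hs, rfl⟩) hys
      -- An entry of the new tuple that `f` sends into `S` is an entry of the root `d`, so `hinter`
      -- applied to `d` puts it into the parent `p`.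
      · exact ⟨y, hinter y hy d hT.root_mem (hS y s hs hys).1, rfl⟩
      · rw [entries_mapTuple] at hys
        obtain ⟨y', hy', hyy⟩ := hys
        obtain rfl | ⟨_, hyd⟩ := hf y' y hyy
        · exact ⟨y', hinter y' hy s hs hy', rfl⟩
        · exact ⟨y, hinter y hy d hT.root_mem hyd, rfl⟩

/-- Each added tuple is hung as a pendant vertex at its parent. The graph lives on all tuples over
`X`, with no edges outside `S`, so that the vertex type stays fixed during the induction; the
connectedness condition for `x` is accordingly phrased by chains of tuples containing `x`. -/
theorem RootedAcyclic.exists_graph (h : RootedAcyclic c S) :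
    ∃ G : SimpleGraph (AnyTuple X), G.IsAcyclic ∧ (∀ a b, G.Adj a b → a ∈ S) ∧
      (∀ a ∈ S, ∀ b ∈ S, G.Reachable a b) ∧
      ∀ x, ∀ a ∈ S, ∀ b ∈ S, x ∈ entries a → x ∈ entries b →
        Relation.ReflTransGen (fun a b => G.Adj a b ∧ x ∈ entries a ∧ x ∈ entries b) a b := by
  classical
  induction h with
  | root =>
    refine ⟨⊥, SimpleGraph.isAcyclic_bot, fun _ _ h => h.elim, ?_, ?_⟩
    · rintro _ rfl _ rfl
      rfl
    · rintro x _ rfl _ rfl _ _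
      exact .refl
  | step S t p hS hp hmeet hinter ih =>
    by_cases ht : t ∈ S
    -- The constructor allows a tuple that is already present; a new edge could then close a cycle,
    -- so the old graph is kept.
    · rwa [Set.insert_eq_of_mem ht]
    obtain ⟨G, hG, hmem, hreach, hbag⟩ := ih
    have htp : t ≠ p := fun h => ht (h ▸ hp)
    have hle : G ≤ G ⊔ SimpleGraph.edge t p := le_sup_left
    have hadj : (G ⊔ SimpleGraph.edge t p).Adj t p := by
      rw [SimpleGraph.sup_adj, SimpleGraph.edge_adj]
      exact Or.inr ⟨Or.inl ⟨rfl, rfl⟩, htp⟩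
    refine ⟨G ⊔ SimpleGraph.edge t p, ?_, ?_, ?_, ?_⟩
    -- All edges of `G` lie within `S`, so `t` is isolated in `G` and the new edge closes no cycle.
    · refine hG.sup_edge_of_not_reachable ?_
      rintro ⟨q⟩
      cases q with
      | nil => exact htp rfl
      | cons h _ => exact ht (hmem _ _ h)
    · intro a b hab
      rw [SimpleGraph.sup_adj, SimpleGraph.edge_adj] at hab
      obtain hab | ⟨⟨rfl, rfl⟩ | ⟨rfl, rfl⟩, _⟩ := hab
      · exact Or.inr (hmem _ _ hab)
      · exact Or.inl rfl
      · exact Or.inr hp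
    · have hp' : ∀ a ∈ insert t S, (G ⊔ SimpleGraph.edge t p).Reachable a p := by
        rintro a (rfl | ha)
        · exact hadj.reachable
        · exact (hreach a ha p hp).mono hle
      exact fun a ha b hb => (hp' a ha).trans (hp' b hb).symm
    · have hmono : ∀ x a b, Relation.ReflTransGen (fun a b => G.Adj a b ∧ x ∈ entries a ∧ x ∈ entries b) a b →
          Relation.ReflTransGen
            (fun a b => (G ⊔ SimpleGraph.edge t p).Adj a b ∧ x ∈ entries a ∧ x ∈ entries b) a b :=
        fun x a b hab => Relation.ReflTransGen.mono (fun _ _ h => ⟨hle h.1, h.2⟩) _ _ hab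
      rintro x a (rfl | ha) b (rfl | hb) hxa hxb
      · exact .refl
      · have hxp := hinter x hxa b hb hxb
        exact .head ⟨hadj, hxa, hxp⟩ (hmono _ _ _ (hbag x p hp b hb hxp hxb))
      · have hxp := hinter x hxb a ha hxa
        exact .tail (hmono _ _ _ (hbag x a ha p hp hxa hxp)) ⟨hadj.symm, hxp, hxb⟩
      · exact hmono _ _ _ (hbag x a ha b hb hxa hxb)

/-- Each added tuple meets its parent, and the entries of a single tuple are pairwise reachable. -/
theorem RootedAcyclic.reachable (h : RootedAcyclic c S) (H : SimpleGraph X)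
    (hH : ∀ s ∈ S, ∀ x ∈ entries s, ∀ y ∈ entries s, x ≠ y → H.Adj x y) {x y : X}
    (hx : x ∈ entries c) {s : AnyTuple X} (hs : s ∈ S) (hy : y ∈ entries s) :
    H.Reachable x y := by
  have hH' : ∀ s ∈ S, ∀ x ∈ entries s, ∀ y ∈ entries s, H.Reachable x y := by
    intro s hs x hx y hy
    by_cases hxy : x = y
    · rw [hxy]
    · exact (hH s hs x hx y hy hxy).reachable
  induction h generalizing s y with
  | root =>
    obtain rfl := hs
    exact hH' _ rfl x hx y hy
  | step S t p hS hp hmeet hinter ih =>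
    have ih' : ∀ {s : AnyTuple X} {y : X}, s ∈ S → y ∈ entries s → H.Reachable x y :=
      fun hs hy => ih (fun s hs => hH s (Or.inr hs)) hs hy fun s hs => hH' s (Or.inr hs)
    obtain rfl | hs := hs
    · obtain ⟨z, hzt, hzp⟩ := hmeet
      exact (ih' hp hzp).trans (hH' s (Or.inl rfl) z hzt y hy)
    · exact ih' hs hy

variable {L : FirstOrder.Language.{u, v}} {C : Type*} [L.Structure C]

theorem RootedAcyclic.isAcyclic {c : AnyTuple C} (h : RootedAcyclic c (tupleSet L C))
    (hC : EveryElementOccurs L C) : IsAcyclic L C := by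
  obtain ⟨G, hG, hmem, hreach, hbag⟩ := h.exists_graph
  have : Nonempty (Tuple L C) := ⟨⟨c, h.root_mem⟩⟩
  refine ⟨G.induce (tupleSet L C), ⟨⟨⟨?_⟩, hG.induce _⟩, fun x => ?_⟩⟩
  · rintro ⟨a, ha⟩ ⟨b, hb⟩
    obtain ⟨q⟩ := hreach a ha b hb
    induction q with
    | nil => rfl
    | cons hadj q ih =>
      have hb' := hmem _ _ hadj.symm
      have hadj' : (G.induce (tupleSet L C)).Adj ⟨_, ha⟩ ⟨_, hb'⟩ := hadj
      exact hadj'.reachable.trans (ih hb' hb)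
  · obtain ⟨d, hd⟩ := hC x
    have : Nonempty {a : Tuple L C | x ∈ entries a.1} := ⟨⟨d, hd⟩⟩
    refine ⟨?_⟩
    rintro ⟨⟨a, ha⟩, hxa⟩ ⟨⟨b, hb⟩, hxb⟩
    have hab := hbag x a ha b hb hxa hxb
    induction hab with
    | refl => rfl
    | tail _ hadj ih =>
      have hb' := hmem _ _ hadj.1
      exact (ih hb' hadj.2.1).trans
        (SimpleGraph.Adj.reachable (SimpleGraph.comap_adj.2 (SimpleGraph.comap_adj.2 hadj.1)))

theorem RootedAcyclic.isConnected (hpos : IsEmpty (L.Relations 0)) {c : Tuple L C}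
    (h : RootedAcyclic c.1 (tupleSet L C)) (hC : EveryElementOccurs L C) : IsConnected L C := by
  have hx : c.1.2 ⟨0, arity_pos hpos c⟩ ∈ entries c.1 := ⟨_, rfl⟩
  have hr : ∀ y, (gaifmanGraph L C).Reachable (c.1.2 ⟨0, arity_pos hpos c⟩) y := by
    intro y
    obtain ⟨d, hd⟩ := hC y
    exact h.reachable (gaifmanGraph L C)
      (fun s hs x hx y hy hxy => ⟨hxy, ⟨s, hs⟩, hx, hy⟩) hx d.2 hd
  have : Nonempty C := ⟨c.1.2 ⟨0, arity_pos hpos c⟩⟩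
  exact ⟨fun x y => (hr x).symm.trans (hr y)⟩

end RootedAcyclic

/-! ### Gluing two sets along a relation -/

section Glued

/-- The disjoint union of `X` and `Y` in which the elements of `Y` that are related to an element
of `X` are dropped. -/
abbrev Glued {X Y : Type*} (Γ : X → Y → Prop) := X ⊕ {y : Y // ¬ ∃ x, Γ x y}

variable {X Y : Type*} {Γ : X → Y → Prop}

open Classical in
/-- The canonical map from the second set to the glued set. -/
noncomputable def Glued.inr (Γ : X → Y → Prop) (y : Y) : Glued Γ :=
  if h : ∃ x, Γ x y then Sum.inl h.choose else Sum.inr ⟨y, h⟩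

theorem Glued.inr_eq (hΓ : ∀ x x' y, Γ x y → Γ x' y → x = x') {x : X} {y : Y} (h : Γ x y) :
    Glued.inr Γ y = Sum.inl x := by
  have h' : ∃ x, Γ x y := ⟨x, h⟩
  rw [Glued.inr, dif_pos h', hΓ _ _ _ h'.choose_spec h]

theorem Glued.rel_of_inr_eq {x : X} {y : Y} (h : Glued.inr Γ y = Sum.inl x) : Γ x y := by
  unfold Glued.inr at h
  split_ifs at h with h'
  exact Sum.inl_injective h ▸ h'.choose_spec

theorem Glued.eq_or_of_inr_eq {y y' : Y} (h : Glued.inr Γ y = Glued.inr Γ y') :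
    y = y' ∨ (∃ x, Γ x y) ∧ ∃ x, Γ x y' := by
  by_cases h1 : ∃ x, Γ x y
  · by_cases h2 : ∃ x, Γ x y'
    · exact Or.inr ⟨h1, h2⟩
    · rw [Glued.inr, Glued.inr, dif_pos h1, dif_neg h2] at h
      exact (Sum.inl_ne_inr h).elim
  · by_cases h2 : ∃ x, Γ x y'
    · rw [Glued.inr, Glued.inr, dif_pos h2, dif_neg h1] at h
      exact (Sum.inr_ne_inl h).elim
    · rw [Glued.inr, Glued.inr, dif_neg h1, dif_neg h2] at h
      exact Or.inl (congrArg Subtype.val (Sum.inr_injective h))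

theorem Glued.inr_coe (y : {y : Y // ¬ ∃ x, Γ x y}) : Glued.inr Γ y.1 = Sum.inr y :=
  dif_neg y.2

end Glued

/-! ### Gluing two structures and homomorphisms from the result -/

section GluedStructure

variable {L : FirstOrder.Language.{u, v}} [L.IsRelational] {X Y : Type*} [L.Structure X]
  [L.Structure Y] (Γ : X → Y → Prop)

/-- The glued structure, whose relations are the images of the relations of its two parts. -/
instance gluedStructure : L.Structure (Glued Γ) where
  funMap f := isEmptyElim f
  RelMap R z := (∃ x, FirstOrder.Language.Structure.RelMap R x ∧ Sum.inl ∘ x = z) ∨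
    ∃ y, FirstOrder.Language.Structure.RelMap R y ∧ Glued.inr Γ ∘ y = z

/-- The first part of the glued structure. -/
def Glued.inlHom : X →[L] Glued Γ where
  toFun := Sum.inl
  map_fun' f := isEmptyElim f
  map_rel' _ x hx := Or.inl ⟨x, hx, rfl⟩

/-- The second part of the glued structure. -/
noncomputable def Glued.inrHom : Y →[L] Glued Γ where
  toFun := Glued.inr Γ
  map_fun' f := isEmptyElim f
  map_rel' _ y hy := Or.inr ⟨y, hy, rfl⟩

theorem tupleSet_glued : tupleSet L (Glued Γ) =
    mapTuple Sum.inl '' tupleSet L X ∪ mapTuple (Glued.inr Γ) '' tupleSet L Y := by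
  ext ⟨n, z⟩
  constructor
  · rintro ⟨R, ⟨x, hx, hz⟩ | ⟨y, hy, hz⟩⟩
    · exact Or.inl ⟨⟨n, x⟩, ⟨R, hx⟩, congrArg (Sigma.mk n) hz⟩
    · exact Or.inr ⟨⟨n, y⟩, ⟨R, hy⟩, congrArg (Sigma.mk n) hz⟩
  · rintro (⟨⟨m, x⟩, ⟨R, hx⟩, h⟩ | ⟨⟨m, y⟩, ⟨R, hy⟩, h⟩)
    · exact h ▸ ⟨R, Or.inl ⟨x, hx, rfl⟩⟩
    · exact h ▸ ⟨R, Or.inr ⟨y, hy, rfl⟩⟩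

/-- Homomorphisms from a glued structure are compatible pairs of homomorphisms. -/
noncomputable def Glued.homEquiv {Γ : X → Y → Prop} (hΓ : ∀ x x' y, Γ x y → Γ x' y → x = x')
    (M : Type*) [L.Structure M] :
    (Glued Γ →[L] M) ≃ {h : (X →[L] M) × (Y →[L] M) // ∀ x y, Γ x y → h.1 x = h.2 y} where
  toFun h := ⟨(h.comp (Glued.inlHom Γ), h.comp (Glued.inrHom Γ)),
    fun _ _ hxy => congrArg h (Glued.inr_eq hΓ hxy).symm⟩
  invFun h :=
    { toFun := Sum.elim h.1.1 fun y => h.1.2 y.1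
      map_fun' := fun f => isEmptyElim f
      map_rel' := by
        rintro n R _ (⟨x, hx, rfl⟩ | ⟨y, hy, rfl⟩)
        · exact h.1.1.map_rel R x hx
        · have h1 : Sum.elim h.1.1 (fun y => h.1.2 y.1) ∘ Glued.inr Γ ∘ y = h.1.2 ∘ y := by
            funext i
            simp only [Function.comp_apply]
            by_cases hy : ∃ x, Γ x (y i)
            · obtain ⟨x, hx⟩ := hy
              rw [Glued.inr_eq hΓ hx]
              exact h.2 _ _ hx
            · rw [Glued.inr, dif_neg hy]
              rfl
          rw [h1]
          exact h.1.2.map_rel R y hy }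
  left_inv h := by
    ext z
    rcases z with x | y
    · rfl
    · exact congrArg h (Glued.inr_coe y)
  right_inv h := by
    refine Subtype.ext (Prod.ext ?_ ?_)
    · rfl
    · ext y
      show Sum.elim h.1.1 (fun y => h.1.2 y.1) (Glued.inr Γ y) = h.1.2 y
      by_cases hy : ∃ x, Γ x y
      · obtain ⟨x, hx⟩ := hy
        rw [Glued.inr_eq hΓ hx]
        exact h.2 _ _ hx
      · rw [Glued.inr, dif_neg hy]
        rfl

end GluedStructure

/-! ### Rooted structures and their counting functions -/

section RootedStructure

/-- A finite structure with a distinguished tuple from which it is acyclic and connected. -/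
structure RootedStructure (L : FirstOrder.Language.{u, v}) where
  /-- The universe. -/
  carrier : Type
  /-- The relations. -/
  [str : L.Structure carrier]
  [finite : Finite carrier]
  /-- The distinguished tuple. -/
  root : Tuple L carrier
  occurs : EveryElementOccurs L carrier
  acyclic : RootedAcyclic root.1 (tupleSet L carrier)

attribute [instance] RootedStructure.str RootedStructure.finite

variable {L : FirstOrder.Language.{u, v}}

/-- The number of homomorphisms that map the root to a given tuple. -/
noncomputable def RootedStructure.count (P : RootedStructure L) {M : Type*} [L.Structure M]
    (a : Tuple L M) : ℕ :=
  Nat.card {h : P.carrier →[L] M // homTuple h P.root = a}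

open Classical in
theorem RootedStructure.sum_count [Finite (Σ n : ℕ, L.Relations n)] (P : RootedStructure L)
    (M : Type*) [L.Structure M] [Finite M] :
    ∑ a : Tuple L M, P.count a = homCount L P.carrier M := by
  have := finite_hom (L := L) P.carrier M
  rw [homCount, ← Nat.card_congr (Equiv.sigmaFiberEquiv fun h : P.carrier →[L] M =>
    homTuple h P.root), Nat.card_sigma]
  rfl

open Classical in
theorem RootedStructure.sum_count_of_subset [Finite (Σ n : ℕ, L.Relations n)] (Q : RootedStructure L)
    {M : Type*} [L.Structure M] [Finite M] (T : Set (Tuple L M)) :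
    ∑ b : Tuple L M, (if b ∈ T then Q.count b else 0) =
      Nat.card {h : Q.carrier →[L] M // homTuple h Q.root ∈ T} := by
  have := finite_hom (L := L) Q.carrier M
  have := Fintype.ofFinite (Q.carrier →[L] M)
  rw [Nat.card_eq_fintype_card, Fintype.card_subtype,
    Finset.card_eq_sum_card_fiberwise (f := fun h => homTuple h Q.root) (t := Finset.univ)
      fun _ _ => Finset.mem_coe.2 (Finset.mem_univ _)]
  refine Finset.sum_congr rfl fun b _ => ?_
  rw [Finset.filter_filter]
  split_ifs with hb
  · rw [RootedStructure.count, Nat.card_eq_fintype_card, Fintype.card_subtype]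
    congr 1
    ext h
    simp only [Finset.mem_filter, Finset.mem_univ, true_and]
    exact ⟨fun h' => ⟨h' ▸ hb, h'⟩, fun h' => h'.2⟩
  · rw [eq_comm, Finset.card_eq_zero, Finset.filter_eq_empty_iff]
    rintro h - ⟨h1, rfl⟩
    exact hb h1

theorem RootedStructure.exists_hom {P : RootedStructure L} {M : Type*} [L.Structure M]
    {a : Tuple L M} (h : P.count a ≠ 0) : ∃ h : P.carrier →[L] M, homTuple h P.root = a := by
  obtain ⟨h⟩ := (Nat.card_ne_zero.1 h).1
  exact ⟨h.1, h.2⟩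

theorem RootedStructure.arity_eq {P : RootedStructure L} {M : Type*} [L.Structure M]
    {a : Tuple L M} (h : P.count a ≠ 0) : a.1.1 = P.root.1.1 := by
  obtain ⟨h, rfl⟩ := P.exists_hom h
  rfl

theorem RootedStructure.stp_subset {P : RootedStructure L} {M : Type*} [L.Structure M]
    {a : Tuple L M} (h : P.count a ≠ 0) : stp P.root.1 P.root.1 ⊆ stp a.1 a.1 := by
  obtain ⟨h, rfl⟩ := P.exists_hom h
  exact stp_subset_stp_mapTuple _ _ _

theorem RootedStructure.atp_subset {P : RootedStructure L} {M : Type*} [L.Structure M]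
    {a : Tuple L M} (h : P.count a ≠ 0) : atp L P.root.1 ⊆ atp L a.1 := by
  obtain ⟨h, rfl⟩ := P.exists_hom h
  exact atp_subset_atp_mapTuple _ _

/-! ### Rooted structures with a single tuple -/

section Leaf

variable [L.IsRelational] {n : ℕ} (R : L.Relations n) (r : Setoid (Fin n))

/-- The structure whose only tuple is the tuple of the classes of an equivalence relation. -/
abbrev leafStructure : L.Structure (Quotient r) where
  funMap f := isEmptyElim f
  RelMap {m} S x := (⟨m, S⟩ : Σ n, L.Relations n) = ⟨n, R⟩ ∧
    (⟨m, x⟩ : AnyTuple (Quotient r)) = ⟨n, Quotient.mk r⟩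

theorem tupleSet_leafStructure :
    letI := leafStructure R r
    tupleSet L (Quotient r) = {⟨n, Quotient.mk r⟩} := by
  ext ⟨m, x⟩
  constructor
  · rintro ⟨S, -, h⟩
    exact h
  · rintro h
    obtain rfl : m = n := congrArg Sigma.fst h
    exact ⟨R, rfl, h⟩

/-- The rooted structure with a single tuple. -/
def leaf : RootedStructure L :=
  letI := leafStructure R r
  { carrier := Quotient r
    root := ⟨⟨n, Quotient.mk r⟩, tupleSet_leafStructure R r ▸ rfl⟩
    occurs := fun x => ⟨⟨⟨n, Quotient.mk r⟩, tupleSet_leafStructure R r ▸ rfl⟩, Quotient.exists_rep x⟩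
    acyclic := by
      show RootedAcyclic (⟨n, Quotient.mk r⟩ : AnyTuple (Quotient r)) _
      rw [tupleSet_leafStructure]
      exact .root }

open Classical in
-- A homomorphism is determined by the image of the only tuple. It exists exactly when `a` lies in
-- the relation `R` and repeats entries wherever `r` demands it.
theorem count_leaf {M : Type*} [L.Structure M] (a : Tuple L M) :
    (leaf R r).count a = if (⟨n, R⟩ : Σ n, L.Relations n) ∈ atp L a.1 ∧
      ∀ i j, r i j → ((i : ℕ), (j : ℕ)) ∈ stp a.1 a.1 then 1 else 0 := by
  let := leafStructure R r
  split_ifs with h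
  · rw [RootedStructure.count, Nat.card_eq_one_iff_unique]
    constructor
    · constructor
      rintro ⟨h, hh⟩ ⟨h', hh'⟩
      exact Subtype.ext (homTuple_injective (leaf R r).occurs (by
        funext ⟨c, hc⟩
        have : c ∈ tupleSet L (Quotient r) := hc
        rw [tupleSet_leafStructure] at this
        obtain rfl := this
        exact hh.trans hh'.symm))
    · obtain ⟨⟨m, a⟩, ha⟩ := a
      obtain ⟨⟨h1, h2⟩, h3⟩ := h
      obtain rfl : n = m := h1
      let f : Quotient r →[L] M :=
        { toFun := Quotient.lift a fun i j hij => mk_mem_stp.1 (h3 i j hij)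
          map_fun' := fun f => isEmptyElim f
          map_rel' := by
            rintro k S x ⟨h4, h5⟩
            obtain rfl : k = n := congrArg Sigma.fst h4
            obtain rfl := eq_of_heq (Sigma.mk.inj h4).2
            obtain rfl := eq_of_heq (Sigma.mk.inj h5).2
            exact h2 }
      exact ⟨⟨f, rfl⟩⟩
  · by_contra hne
    obtain ⟨f, rfl⟩ := RootedStructure.exists_hom hne
    refine h ⟨atp_subset_atp_mapTuple (L := L) f _ (mk_mem_atp.2 ⟨rfl, rfl⟩), fun i j hij => ?_⟩
    exact stp_subset_stp_mapTuple f _ _ (mk_mem_stp.2 (Quotient.sound hij))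

end Leaf

/-! ### Attaching one rooted structure to another -/

section Attach

/-- Positions of `a` and `b` are related by `p`, and hold the elements `x` and `y`. -/
def PositionRel {X Y : Type*} (a : AnyTuple X) (b : AnyTuple Y) (p : Set (ℕ × ℕ)) (x : X) (y : Y) :
    Prop :=
  ∃ (i : Fin a.1) (j : Fin b.1), ((i : ℕ), (j : ℕ)) ∈ p ∧ a.2 i = x ∧ b.2 j = y

/-- The positions related by `p` can be identified without identifying entries of `a`. -/
def Compatible {X Y : Type*} (a : AnyTuple X) (b : AnyTuple Y) (p : Set (ℕ × ℕ)) : Prop :=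
  ∀ i i' j j', (i, j) ∈ p → (i', j') ∈ p → (j, j') ∈ stp b b → (i, i') ∈ stp a a

/-- This is the uniqueness that gluing requires: an element of the second structure is identified
with at most one element of the first. -/
theorem Compatible.eq_of_positionRel {X Y : Type*} {a : AnyTuple X} {b : AnyTuple Y}
    {p : Set (ℕ × ℕ)} (h : Compatible a b p) {x x' : X} {y : Y} (hx : PositionRel a b p x y)
    (hx' : PositionRel a b p x' y) : x = x' := by
  obtain ⟨i, j, hij, rfl, hj⟩ := hx
  obtain ⟨i', j', hij', rfl, hj'⟩ := hx'
  exact mk_mem_stp.1 (h _ _ _ _ hij hij' (mk_mem_stp.2 (hj.trans hj'.symm)))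

variable [L.IsRelational] (P Q : RootedStructure L) (p : Set (ℕ × ℕ))

/-- The rooted structure that arises by gluing the root of `Q` to the root of `P` along `p`. -/
noncomputable def RootedStructure.attach (hp : Compatible P.root.1 Q.root.1 p)
    (hne : ∃ x y, PositionRel P.root.1 Q.root.1 p x y) : RootedStructure L where
  carrier := Glued (PositionRel P.root.1 Q.root.1 p)
  root := homTuple (Glued.inlHom _) P.root
  occurs := by
    rintro (x | y)
    · obtain ⟨a, i, rfl⟩ := P.occurs x
      exact ⟨homTuple (Glued.inlHom _) a, i, rfl⟩
    · obtain ⟨a, i, hi⟩ := Q.occurs y.1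
      exact ⟨homTuple (Glued.inrHom _) a, i, (congrArg _ hi).trans (Glued.inr_coe y)⟩
  acyclic := by
    change RootedAcyclic (mapTuple Sum.inl P.root.1) _
    rw [tupleSet_glued]
    refine (P.acyclic.image Sum.inl_injective).union_image Q.acyclic _ ?_ ?_ ?_
    · obtain ⟨x, y, hxy⟩ := hne
      have hxy' := hxy
      obtain ⟨i, j, hij, rfl, rfl⟩ := hxy'
      exact ⟨_, ⟨j, Glued.inr_eq (Γ := PositionRel P.root.1 Q.root.1 p)
        (fun _ _ _ => hp.eq_of_positionRel) hxy⟩, ⟨i, rfl⟩⟩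
    · rintro y _ ⟨s, hs, rfl⟩ hy
      rw [entries_mapTuple] at hy
      obtain ⟨x, hx, hxy⟩ := hy
      obtain ⟨i, j, hij, rfl, rfl⟩ := Glued.rel_of_inr_eq hxy.symm
      exact ⟨⟨j, rfl⟩, ⟨i, hxy⟩⟩
    · intro y y' h
      refine (Glued.eq_or_of_inr_eq h).imp id ?_
      rintro ⟨⟨_, _, j, _, _, hj⟩, ⟨_, _, j', _, _, hj'⟩⟩
      exact ⟨⟨j, hj⟩, ⟨j', hj'⟩⟩

/-- The first structure embeds injectively into the glued one, so its root acquires no new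
equalities. This allows further structures to be attached to the same root. -/
theorem RootedStructure.stp_root_attach (hp : Compatible P.root.1 Q.root.1 p)
    (hne : ∃ x y, PositionRel P.root.1 Q.root.1 p x y) :
    stp (P.attach Q p hp hne).root.1 (P.attach Q p hp hne).root.1 = stp P.root.1 P.root.1 := by
  refine subset_antisymm ?_ (stp_subset_stp_mapTuple _ _ _)
  rintro _ ⟨i, j, rfl, h⟩
  exact ⟨i, j, rfl, Sum.inl_injective h⟩

variable [Finite (Σ n : ℕ, L.Relations n)]

open Classical in
-- A homomorphism from the glued structure is a pair of homomorphisms agreeing on identified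
-- elements. If they send the roots to `a` and `b`, agreement means exactly `p ⊆ stp a b`; `hbound`
-- ensures that every pair in `p` refers to actual positions.
theorem RootedStructure.count_attach (hp : Compatible P.root.1 Q.root.1 p)
    (hne : ∃ x y, PositionRel P.root.1 Q.root.1 p x y)
    (hbound : ∀ i j, (i, j) ∈ p → i < P.root.1.1 ∧ j < Q.root.1.1)
    {M : Type*} [L.Structure M] [Finite M] (a : Tuple L M) :
    (P.attach Q p hp hne).count a =
      P.count a * ∑ b : Tuple L M, if p ⊆ stp a.1 b.1 then Q.count b else 0 := by
  have h1 := Q.sum_count_of_subset {b : Tuple L M | p ⊆ stp a.1 b.1}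
  simp only [Set.mem_ofPred_eq] at h1
  rw [h1, RootedStructure.count, RootedStructure.count, ← Nat.card_prod]
  have key : ∀ (h : P.carrier →[L] M) (h' : Q.carrier →[L] M), homTuple h P.root = a →
      ((∀ x y, PositionRel P.root.1 Q.root.1 p x y → h x = h' y) ↔
        p ⊆ stp a.1 (homTuple h' Q.root).1) := by
    rintro h h' rfl
    constructor
    · rintro hh ⟨i, j⟩ hij
      obtain ⟨hi, hj⟩ := hbound i j hij
      exact mem_stp_iff.2 ⟨hi, hj, hh _ _ ⟨⟨i, hi⟩, ⟨j, hj⟩, hij, rfl, rfl⟩⟩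
    · rintro hh _ _ ⟨i, j, hij, rfl, rfl⟩
      obtain ⟨_, _, h2⟩ := mem_stp_iff.1 (hh hij)
      exact h2
  have hroot : ∀ h : (P.attach Q p hp hne).carrier →[L] M,
      homTuple h (P.attach Q p hp hne).root = homTuple (h.comp (Glued.inlHom _)) P.root :=
    fun _ => rfl
  let e := Glued.homEquiv (L := L) (Γ := PositionRel P.root.1 Q.root.1 p)
    (fun _ _ _ => hp.eq_of_positionRel) M
  refine Nat.card_congr
    { toFun := fun h => (⟨(e h.1).1.1, h.2⟩, ⟨(e h.1).1.2, (key _ _ h.2).1 (e h.1).2⟩)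
      invFun := fun h => ⟨e.symm ⟨(h.1.1, h.2.1), (key _ _ h.1.2).2 h.2.2⟩, h.1.2⟩
      left_inv := fun h => Subtype.ext (e.symm_apply_apply h.1)
      right_inv := ?_ }
  rintro ⟨⟨h, hh⟩, ⟨h', hh'⟩⟩
  have h2 := e.apply_symm_apply ⟨(h, h'), (key _ _ hh).2 hh'⟩
  refine Prod.ext (Subtype.ext ?_) (Subtype.ext ?_)
  · exact congrArg (fun z => z.1.1) h2
  · exact congrArg (fun z => z.1.2) h2

end Attach

end RootedStructure

/-! ### Products of counting functions by gluing roots -/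

section Diagonal

/-- The identity on the first `n` positions. -/
def diagonal (n : ℕ) : Set (ℕ × ℕ) := {p | p.1 = p.2 ∧ p.1 < n}

theorem eq_of_diagonal_subset {X : Type*} {n : ℕ} {a b : AnyTuple X} (ha : a.1 = n) (hb : b.1 = n)
    (h : diagonal n ⊆ stp a b) : a = b := by
  refine anyTuple_ext (ha.trans hb.symm) fun i hi hj => ?_
  obtain ⟨_, _, h1⟩ := mem_stp_iff.1 (h (show (i, i) ∈ diagonal n from ⟨rfl, ha ▸ hi⟩))
  exact h1

theorem diagonal_subset_stp {X : Type*} (a : AnyTuple X) : diagonal a.1 ⊆ stp a a := by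
  rintro ⟨i, j⟩ ⟨h, hi⟩
  obtain rfl : i = j := h
  exact mem_stp_iff.2 ⟨hi, hi, rfl⟩

variable {L : FirstOrder.Language.{u, v}} [L.IsRelational] (P Q : RootedStructure L)

theorem compatible_diagonal {X Y : Type*} {a : AnyTuple X} {b : AnyTuple Y}
    (h : stp b b ⊆ stp a a) : Compatible a b (diagonal a.1) := by
  rintro i i' j j' ⟨hij, -⟩ ⟨hij', -⟩ hj
  obtain rfl : i = j := hij
  obtain rfl : i' = j' := hij'
  exact h hj

/-- Gluing two rooted structures at their roots, where the second root is mapped to the first. -/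
noncomputable def RootedStructure.attachRoot (hpos : IsEmpty (L.Relations 0))
    (harity : Q.root.1.1 = P.root.1.1) (hstp : stp Q.root.1 Q.root.1 ⊆ stp P.root.1 P.root.1) :
    RootedStructure L :=
  P.attach Q (diagonal P.root.1.1) (compatible_diagonal hstp)
    ⟨_, _, ⟨0, arity_pos hpos _⟩, ⟨0, harity ▸ arity_pos hpos P.root⟩, ⟨rfl, arity_pos hpos P.root⟩, rfl, rfl⟩

theorem RootedStructure.stp_root_attachRoot (hpos : IsEmpty (L.Relations 0))
    (harity : Q.root.1.1 = P.root.1.1) (hstp : stp Q.root.1 Q.root.1 ⊆ stp P.root.1 P.root.1) :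
    stp (P.attachRoot Q hpos harity hstp).root.1 (P.attachRoot Q hpos harity hstp).root.1 =
      stp P.root.1 P.root.1 :=
  P.stp_root_attach Q _ _ _

/-- In the sum of `count_attach` only `b = a` survives: a tuple of the arity of the root that agrees
with `a` at every position is `a` itself. -/
theorem RootedStructure.count_attachRoot [Finite (Σ n : ℕ, L.Relations n)]
    (hpos : IsEmpty (L.Relations 0))
    (harity : Q.root.1.1 = P.root.1.1) (hstp : stp Q.root.1 Q.root.1 ⊆ stp P.root.1 P.root.1)
    {M : Type*} [L.Structure M] [Finite M] (a : Tuple L M) :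
    (P.attachRoot Q hpos harity hstp).count a = P.count a * Q.count a := by
  classical
  rw [RootedStructure.attachRoot, RootedStructure.count_attach]
  · by_cases ha : P.count a = 0
    · rw [ha, zero_mul, zero_mul]
    congr 1
    have haP := RootedStructure.arity_eq ha
    rw [Finset.sum_eq_single a]
    · exact if_pos (haP ▸ diagonal_subset_stp a.1)
    · intro b _ hb
      split_ifs with h
      · by_contra hQ
        exact hb (Subtype.ext
          (eq_of_diagonal_subset haP ((RootedStructure.arity_eq hQ).trans harity) h).symm)
      · rfl
    · exact fun h => absurd (Finset.mem_univ a) h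
  · rintro i j ⟨h, hi⟩
    obtain rfl : i = j := h
    exact ⟨hi, harity ▸ hi⟩

/-- The finest equivalence relation on the positions of the root of `P` that identifies the
positions of equal entries in the roots of `P` and `Q`. -/
def joinSetoid : Setoid (Fin P.root.1.1) :=
  Relation.EqvGen.setoid fun i j =>
    ((i : ℕ), (j : ℕ)) ∈ stp P.root.1 P.root.1 ∨ ((i : ℕ), (j : ℕ)) ∈ stp Q.root.1 Q.root.1

theorem stp_leaf {n : ℕ} (R : L.Relations n) (r : Setoid (Fin n)) {i j : Fin n} :
    ((i : ℕ), (j : ℕ)) ∈ stp (leaf R r).root.1 (leaf R r).root.1 ↔ r i j :=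
  (mk_mem_stp (a := (leaf R r).root.1) (b := (leaf R r).root.1)).trans Quotient.eq

/-- The common root of a product of rooted structures. -/
noncomputable def productLeaf : RootedStructure L := leaf P.root.2.choose (joinSetoid P Q)

theorem stp_subset_stp_productLeaf {S : RootedStructure L} (hS : S.root.1.1 = P.root.1.1)
    (h : ∀ i j : ℕ, (i, j) ∈ stp S.root.1 S.root.1 → (i, j) ∈ stp P.root.1 P.root.1 ∨
        (i, j) ∈ stp Q.root.1 Q.root.1) :
    stp S.root.1 S.root.1 ⊆ stp (productLeaf P Q).root.1 (productLeaf P Q).root.1 := by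
  rintro ⟨i, j⟩ hij
  obtain ⟨hi, hj, _⟩ := mem_stp_iff.1 hij
  rw [hS] at hi hj
  exact (stp_leaf _ (joinSetoid P Q) (i := ⟨i, hi⟩) (j := ⟨j, hj⟩)).2
    (Relation.EqvGen.rel _ _ (h i j hij))

/-- If both counts are nonzero, `a` satisfies the equalities of both roots, hence all equalities
they generate, and it lies in the relation chosen for the root of `P`. -/
theorem count_productLeaf {M : Type*} [L.Structure M] {a : Tuple L M} (hP : P.count a ≠ 0)
    (hQ : Q.count a ≠ 0) : (productLeaf P Q).count a = 1 := by
  rw [productLeaf, count_leaf, if_pos]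
  refine ⟨RootedStructure.atp_subset hP (mem_atp_iff.2 P.root.2.choose_spec), fun i j hij => ?_⟩
  induction hij with
  | rel i j h =>
    exact h.elim (fun h => RootedStructure.stp_subset hP h)
      fun h => RootedStructure.stp_subset hQ h
  | refl i => exact RootedStructure.stp_subset hP (mk_mem_stp.2 rfl)
  | symm i j _ ih => exact stp_symm ih
  | trans i j k _ _ ih ih' => exact stp_trans ih ih'

/-- The product of two rooted structures with roots of the same arity. -/
noncomputable def RootedStructure.mul (hpos : IsEmpty (L.Relations 0))
    (harity : Q.root.1.1 = P.root.1.1) : RootedStructure L :=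
  -- The roots of `P` and `Q` may have incomparable equality patterns, while attaching requires the
  -- pattern of the attached root to be contained in that of the base. Hence both are attached to a
  -- leaf whose root satisfies both patterns.
  ((productLeaf P Q).attachRoot P hpos rfl
    (stp_subset_stp_productLeaf P Q rfl fun _ _ => Or.inl)).attachRoot Q hpos harity
    ((stp_subset_stp_productLeaf P Q harity fun _ _ => Or.inr).trans
      (RootedStructure.stp_root_attachRoot _ _ _ _ _).ge)

/-- The auxiliary leaf contributes the factor 1 wherever the other two factors are nonzero. -/
theorem RootedStructure.count_mul [Finite (Σ n : ℕ, L.Relations n)]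
    (hpos : IsEmpty (L.Relations 0)) (harity : Q.root.1.1 = P.root.1.1)
    {M : Type*} [L.Structure M] [Finite M] (a : Tuple L M) :
    (P.mul Q hpos harity).count a = P.count a * Q.count a := by
  refine (RootedStructure.count_attachRoot _ _ hpos _ _ a).trans
    ((congrArg (· * Q.count a) (RootedStructure.count_attachRoot _ _ hpos _ _ a)).trans ?_)
  by_cases hP : P.count a = 0
  · rw [hP, mul_zero]
  by_cases hQ : Q.count a = 0
  · rw [hQ, mul_zero, mul_zero]
  rw [count_productLeaf P Q hP hQ, one_mul]

end Diagonal

/-! ### Indicators in an algebra of functions on a finite set -/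

section Algebra

variable {X : Type*} [Fintype X]

/-- A linear space of functions on a finite set that is closed under products and does not vanish
anywhere contains the indicators of all sets that it does not split. -/
theorem indicator_mem {W : Submodule ℚ (X → ℚ)} (hmul : ∀ f ∈ W, ∀ g ∈ W, f * g ∈ W)
    (hne : ∀ x, ∃ f ∈ W, f x ≠ 0) {S : Set X}
    (hS : ∀ x y, (∀ f ∈ W, f x = f y) → x ∈ S → y ∈ S) : S.indicator 1 ∈ W := by
  classical
  -- `W` is not assumed to contain the constant 1; a function with value 1 at `x` replaces it.
  have hunit : ∀ x, ∃ f ∈ W, f x = 1 := by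
    intro x
    obtain ⟨f, hf, hfx⟩ := hne x
    exact ⟨(f x)⁻¹ • f, W.smul_mem _ hf, inv_mul_cancel₀ hfx⟩
  have hsep : ∀ x y, (¬ ∀ f ∈ W, f x = f y) → ∃ f ∈ W, f x = 1 ∧ f y = 0 := by
    intro x y hxy
    push Not at hxy
    obtain ⟨f, hf, hfxy⟩ := hxy
    obtain ⟨e, he, hex⟩ := hunit x
    -- The function `e * (f - f y)` vanishes at `y` and has value `f x - f y` at `x`; it is expanded
    -- because constants need not lie in `W`.
    refine ⟨(f x - f y)⁻¹ • (e * f - f y • e),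
      W.smul_mem _ (W.sub_mem (hmul _ he _ hf) (W.smul_mem _ he)), ?_, ?_⟩
    · simp only [Pi.smul_apply, Pi.sub_apply, Pi.mul_apply, smul_eq_mul, hex, one_mul, mul_one]
      exact inv_mul_cancel₀ (sub_ne_zero.2 hfxy)
    · simp only [Pi.smul_apply, Pi.sub_apply, Pi.mul_apply, smul_eq_mul]
      ring
  -- A product of functions separating `x` from each point outside its class vanishes off the class.
  -- On the class it is constantly 1, being an element of `W` with value 1 at `x`.
  have hclass : ∀ x, {y | ∀ f ∈ W, f x = f y}.indicator (1 : X → ℚ) ∈ W := by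
    intro x
    have hT : ∀ T : Finset X, (∀ y ∈ T, ¬ ∀ f ∈ W, f x = f y) →
        ∃ f ∈ W, f x = 1 ∧ ∀ y ∈ T, f y = 0 := by
      intro T
      induction T using Finset.induction_on with
      | empty =>
        intro _
        obtain ⟨f, hf, hfx⟩ := hunit x
        exact ⟨f, hf, hfx, by simp⟩
      | insert y T _ ih =>
        intro h
        obtain ⟨f, hf, hfx, hfT⟩ := ih fun z hz => h z (Finset.mem_insert_of_mem hz)
        obtain ⟨g, hg, hgx, hgy⟩ := hsep x y (h y (Finset.mem_insert_self _ _))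
        refine ⟨f * g, hmul _ hf _ hg, by simp [hfx, hgx], fun z hz => ?_⟩
        obtain rfl | hz := Finset.mem_insert.1 hz
        · simp [hgy]
        · simp [hfT z hz]
    obtain ⟨f, hf, hfx, hf0⟩ := hT (Finset.univ.filter fun y => ¬ ∀ f ∈ W, f x = f y)
      fun y hy => (Finset.mem_filter.1 hy).2
    convert hf using 1
    funext y
    by_cases hy : ∀ f ∈ W, f x = f y
    · rw [Set.indicator_of_mem (show y ∈ {y | ∀ f ∈ W, f x = f y} from hy), ← hy f hf, hfx,
        Pi.one_apply]
    · rw [Set.indicator_of_notMem (show y ∉ {y | ∀ f ∈ W, f x = f y} from hy),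
        hf0 y (Finset.mem_filter.2 ⟨Finset.mem_univ _, hy⟩)]
  have hunion : ∀ T : Finset X,
      {y | ∃ x ∈ T, ∀ f ∈ W, f x = f y}.indicator (1 : X → ℚ) ∈ W := by
    intro T
    induction T using Finset.induction_on with
    | empty =>
      convert W.zero_mem using 1
      funext y
      simp
    | insert x T _ ih =>
      -- The indicator of a union is the sum of the two indicators minus their product.
      convert W.sub_mem (W.add_mem (hclass x) ih) (hmul _ (hclass x) _ ih) using 1
      funext y
      simp only [Set.indicator, Finset.mem_insert, Set.mem_ofPred_eq, Pi.add_apply, Pi.sub_apply,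
        Pi.mul_apply, Pi.one_apply, or_and_right, exists_or, exists_eq_left]
      by_cases h1 : ∀ f ∈ W, f x = f y <;> by_cases h2 : ∃ x ∈ T, ∀ f ∈ W, f x = f y <;>
        simp [h1, h2]
  convert hunion (Finset.univ.filter (· ∈ S)) using 2
  ext y
  constructor
  · exact fun hy => ⟨y, Finset.mem_filter.2 ⟨Finset.mem_univ _, hy⟩, fun _ _ => rfl⟩
  · rintro ⟨x, hx, hxy⟩
    exact hS x y hxy (Finset.mem_filter.1 hx).2

end Algebra

/-! ### Inversion over a partial order -/

section Moebius

open Classical in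
theorem countP_le_eq_sum {α : Type*} [PartialOrder α] (m : Multiset α) (F : Finset α)
    (hF : ∀ r ∈ m, r ∈ F) (q : α) :
    m.countP (q ≤ ·) = ∑ r ∈ F, if q ≤ r then m.count r else 0 := by
  rw [Multiset.countP_eq_card_filter,
    ← Multiset.sum_count_eq_card (s := F) fun r hr => hF r (Multiset.mem_of_mem_filter hr)]
  exact Finset.sum_congr rfl fun r _ => Multiset.count_filter

open Classical in
/-- Multisets in a partial order are determined above `U` by the numbers of elements above the
elements of an upper set `U`. -/
theorem count_eq_of_countP_le_eq {α : Type*} [PartialOrder α] {m m' : Multiset α} {U : Set α}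
    (hU : IsUpperSet U) (h : ∀ q ∈ U, m.countP (q ≤ ·) = m'.countP (q ≤ ·)) :
    ∀ q ∈ U, m.count q = m'.count q := by
  by_contra! hbad
  obtain ⟨q₀, hq₀, hne₀⟩ := hbad
  let F := m.toFinset ∪ m'.toFinset
  have hfin : {q | q ∈ U ∧ m.count q ≠ m'.count q}.Finite := by
    refine F.finite_toSet.subset ?_
    rintro q ⟨_, hq⟩
    by_contra hqF
    simp only [F, Finset.coe_union, Set.mem_union, Finset.mem_coe, Multiset.mem_toFinset,
      not_or] at hqF
    exact hq ((Multiset.count_eq_zero_of_notMem hqF.1).trans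
      (Multiset.count_eq_zero_of_notMem hqF.2).symm)
  -- At a maximal disagreement `q` all terms strictly above `q` coincide, as they stay in the upper
  -- set `U`. The equation for `q` then forces agreement at `q`.
  obtain ⟨q, ⟨hq, hne⟩, hmax⟩ := hfin.exists_maximal ⟨q₀, hq₀, hne₀⟩
  have h1 := h q hq
  rw [countP_le_eq_sum m F (fun r hr => Finset.mem_union_left _ (Multiset.mem_toFinset.2 hr)),
    countP_le_eq_sum m' F (fun r hr => Finset.mem_union_right _ (Multiset.mem_toFinset.2 hr))] at h1
  have hqF : q ∈ F := by
    by_contra hqF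
    simp only [F, Finset.mem_union, Multiset.mem_toFinset, not_or] at hqF
    exact hne ((Multiset.count_eq_zero_of_notMem hqF.1).trans
      (Multiset.count_eq_zero_of_notMem hqF.2).symm)
  rw [← Finset.add_sum_erase _ _ hqF, ← Finset.add_sum_erase _ _ hqF, if_pos le_rfl, if_pos le_rfl,
    Finset.sum_congr rfl (g := fun r => if q ≤ r then m'.count r else 0) ?_] at h1
  · exact hne (Nat.add_right_cancel h1)
  · intro r hr
    split_ifs with hqr
    · by_contra hr'
      exact (Finset.ne_of_mem_erase hr) (le_antisymm (hmax ⟨hU hqr hq, hr'⟩ hqr) hqr)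
    · rfl

end Moebius

/-! ### The span of the counting functions determines the colors -/

section Span

variable (L : FirstOrder.Language.{u, v}) (A : Type w) (B : Type w') [L.Structure A]
  [L.Structure B]

/-- The tuples of two structures. -/
abbrev TwoTuple : Type max w w' := Tuple L A ⊕ Tuple L B

variable {L A B}

/-- The counts of a rooted structure on the tuples of two structures. -/
noncomputable def RootedStructure.vec (P : RootedStructure L) : TwoTuple L A B → ℚ :=
  Sum.elim (fun a => (P.count a : ℚ)) fun b => (P.count b : ℚ)

/-- The arity of a tuple of one of two structures. -/
def TwoTuple.arity : TwoTuple L A B → ℕ := Sum.elim (fun a => a.1.1) fun b => b.1.1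

/-- The atomic type of a tuple of one of two structures. -/
def TwoTuple.atp : TwoTuple L A B → Set (Σ n : ℕ, L.Relations n) :=
  Sum.elim (fun a => RelColRef.atp L a.1) fun b => RelColRef.atp L b.1

/-- The similarity type of a tuple of one of two structures with itself. -/
def TwoTuple.stp : TwoTuple L A B → Set (ℕ × ℕ) :=
  Sum.elim (fun a => RelColRef.stp a.1 a.1) fun b => RelColRef.stp b.1 b.1

variable (L A B)

/-- The span of the counts of rooted structures. -/
noncomputable def countSpan : Submodule ℚ (TwoTuple L A B → ℚ) :=
  Submodule.span ℚ (Set.range fun P : RootedStructure L => P.vec)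

variable {L A B}

theorem vec_mem_countSpan (P : RootedStructure L) : P.vec ∈ countSpan L A B :=
  Submodule.subset_span ⟨P, rfl⟩

theorem RootedStructure.arity_eq_of_vec {P : RootedStructure L} {x : TwoTuple L A B}
    (h : P.vec x ≠ 0) : x.arity = P.root.1.1 := by
  rcases x with a | b <;> exact RootedStructure.arity_eq (Nat.cast_ne_zero.1 h)

theorem RootedStructure.stp_subset_of_vec {P : RootedStructure L} {x : TwoTuple L A B}
    (h : P.vec x ≠ 0) : stp P.root.1 P.root.1 ⊆ x.stp := by
  rcases x with a | b <;> exact RootedStructure.stp_subset (Nat.cast_ne_zero.1 h)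

theorem RootedStructure.atp_subset_of_vec {P : RootedStructure L} {x : TwoTuple L A B}
    (h : P.vec x ≠ 0) : atp L P.root.1 ⊆ x.atp := by
  rcases x with a | b <;> exact RootedStructure.atp_subset (Nat.cast_ne_zero.1 h)

theorem TwoTuple.atp_nonempty (x : TwoTuple L A B) : x.atp.Nonempty := by
  rcases x with a | b
  · exact ⟨_, mem_atp_iff.2 a.2.choose_spec⟩
  · exact ⟨_, mem_atp_iff.2 b.2.choose_spec⟩

/-- Two tuples on which all elements of the span agree. -/
def Indistinguishable (x y : TwoTuple L A B) : Prop := ∀ f ∈ countSpan L A B, f x = f y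

theorem Indistinguishable.symm {x y : TwoTuple L A B} (h : Indistinguishable x y) :
    Indistinguishable y x := fun f hf => (h f hf).symm

section Relational

variable [L.IsRelational]

/-- The witness is the single tuple with exactly the repetitions of `a`. Its count is 1 at `a`, and
nonzero elsewhere only at tuples that lie in `R` and repeat at least these entries; this lets the
span detect atomic and similarity types. -/
theorem exists_count_eq_one {M : Type*} [L.Structure M] {a : Tuple L M} {R : Σ n, L.Relations n}
    (hR : R ∈ atp L a.1) : ∃ P : RootedStructure L, R ∈ atp L P.root.1 ∧
      stp P.root.1 P.root.1 = stp a.1 a.1 ∧ P.count a = 1 := by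
  obtain ⟨⟨m, a⟩, ha⟩ := a
  obtain ⟨n, R⟩ := R
  obtain ⟨h, hR⟩ := hR
  obtain rfl : n = m := h
  refine ⟨leaf R (Setoid.ker a), mk_mem_atp.2 ⟨rfl, rfl⟩, ?_, ?_⟩
  · ext ⟨i, j⟩
    constructor
    · intro h
      obtain ⟨hi, hj, _⟩ := mem_stp_iff.1 h
      exact mem_stp_iff.2 ⟨hi, hj, (stp_leaf R (Setoid.ker a) (i := ⟨i, hi⟩) (j := ⟨j, hj⟩)).1 h⟩
    · intro h
      obtain ⟨hi, hj, h⟩ := mem_stp_iff.1 h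
      exact (stp_leaf R (Setoid.ker a) (i := ⟨i, hi⟩) (j := ⟨j, hj⟩)).2 h
  · rw [count_leaf, if_pos ⟨mk_mem_atp.2 hR, fun i j hij => mk_mem_stp.2 hij⟩]

theorem TwoTuple.exists_vec_eq_one {x : TwoTuple L A B} {R : Σ n, L.Relations n}
    (hR : R ∈ x.atp) : ∃ P : RootedStructure L, R ∈ RelColRef.atp L P.root.1 ∧
      RelColRef.stp P.root.1 P.root.1 = x.stp ∧ P.vec x = 1 := by
  rcases x with a | b
  · obtain ⟨P, h1, h2, h3⟩ := exists_count_eq_one (a := a) hR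
    exact ⟨P, h1, h2, Nat.cast_eq_one.2 h3⟩
  · obtain ⟨P, h1, h2, h3⟩ := exists_count_eq_one (a := b) hR
    exact ⟨P, h1, h2, Nat.cast_eq_one.2 h3⟩

theorem Indistinguishable.atp_subset {x y : TwoTuple L A B} (h : Indistinguishable x y) :
    x.atp ⊆ y.atp := by
  intro R hR
  obtain ⟨P, hRP, -, hP⟩ := TwoTuple.exists_vec_eq_one hR
  refine RootedStructure.atp_subset_of_vec (P := P) ?_ hRP
  rw [← h _ (vec_mem_countSpan P), hP]
  exact one_ne_zero

theorem Indistinguishable.stp_subset {x y : TwoTuple L A B} (h : Indistinguishable x y) :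
    x.stp ⊆ y.stp := by
  obtain ⟨R, hR⟩ := x.atp_nonempty
  obtain ⟨P, -, hstp, hP⟩ := TwoTuple.exists_vec_eq_one hR
  refine hstp ▸ RootedStructure.stp_subset_of_vec (P := P) ?_
  rw [← h _ (vec_mem_countSpan P), hP]
  exact one_ne_zero

theorem Indistinguishable.stp_eq {x y : TwoTuple L A B} (h : Indistinguishable x y) :
    x.stp = y.stp := h.stp_subset.antisymm h.symm.stp_subset

end Relational

variable [Finite (Σ n : ℕ, L.Relations n)] [Finite A] [Finite B]

/-- The color of a tuple of one of two structures. -/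
noncomputable def TwoTuple.color (i : ℕ) : TwoTuple L A B → Color L i :=
  Sum.elim (fun a => RelColRef.color L i a) fun b => RelColRef.color L i b

open Classical in
/-- The sum of a function over the tuples of the same structure whose similarity type with a
given tuple contains `p`. -/
noncomputable def TwoTuple.sumAbove (p : Set (ℕ × ℕ)) (f : TwoTuple L A B → ℚ) :
    TwoTuple L A B → ℚ :=
  Sum.elim (fun a => ∑ a' : Tuple L A, if p ⊆ RelColRef.stp a.1 a'.1 then f (.inl a') else 0)
    fun b => ∑ b' : Tuple L B, if p ⊆ RelColRef.stp b.1 b'.1 then f (.inr b') else 0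

theorem TwoTuple.sumAbove_add (p : Set (ℕ × ℕ)) (f g : TwoTuple L A B → ℚ) :
    sumAbove p (f + g) = sumAbove p f + sumAbove p g := by
  classical
  funext x
  rcases x with a | b <;>
  · simp only [sumAbove, Sum.elim_inl, Sum.elim_inr, Pi.add_apply, ← Finset.sum_add_distrib]
    refine Finset.sum_congr rfl fun z _ => ?_
    split_ifs <;> simp

theorem TwoTuple.sumAbove_smul (p : Set (ℕ × ℕ)) (c : ℚ) (f : TwoTuple L A B → ℚ) :
    sumAbove p (c • f) = c • sumAbove p f := by
  classical
  funext x
  rcases x with a | b <;>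
  · simp only [sumAbove, Sum.elim_inl, Sum.elim_inr, Pi.smul_apply, Finset.smul_sum]
    refine Finset.sum_congr rfl fun z _ => ?_
    split_ifs <;> simp

/-- A nonzero term provides a tuple `b` that matches `a` along `p` and is an image of the root of
`Q`, so equalities in that root pass through `b` to `a`. Contrapositively, the sum vanishes whenever
`Q` cannot be attached along `p` to a root with the equality pattern of `a`. -/
theorem mem_of_sum_count_ne_zero {M : Type*} [L.Structure M] [Finite M] {Q : RootedStructure L}
    {p : Set (ℕ × ℕ)} {f : Tuple L M → ℚ} (hf : ∀ b, f b = Q.count b) {a : Tuple L M}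
    [∀ b : Tuple L M, Decidable (p ⊆ stp a.1 b.1)]
    (h : ∑ b : Tuple L M, (if p ⊆ stp a.1 b.1 then f b else 0) ≠ 0) :
    (∀ i j, (i, j) ∈ p → j < Q.root.1.1) ∧ ∀ i i' j j', (i, j) ∈ p → (i', j') ∈ p →
      (j, j') ∈ stp Q.root.1 Q.root.1 → (i, i') ∈ stp a.1 a.1 := by
  obtain ⟨b, -, hb⟩ := Finset.exists_ne_zero_of_sum_ne_zero h
  split_ifs at hb with hpb
  · rw [hf, Nat.cast_ne_zero] at hb
    refine ⟨fun i j hij => ?_, fun i i' j j' hij hij' hj => ?_⟩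
    · obtain ⟨_, hj, _⟩ := mem_stp_iff.1 (hpb hij)
      exact RootedStructure.arity_eq hb ▸ hj
    · exact stp_trans (stp_trans (hpb hij) (RootedStructure.stp_subset hb hj))
        (stp_symm (hpb hij'))
  · exact absurd rfl hb

theorem TwoTuple.compatible_of_sumAbove_ne_zero {Q : RootedStructure L} {p : Set (ℕ × ℕ)}
    {x : TwoTuple L A B} (h : sumAbove p Q.vec x ≠ 0) :
    (∀ i j, (i, j) ∈ p → j < Q.root.1.1) ∧ ∀ i i' j j', (i, j) ∈ p → (i', j') ∈ p →
      (j, j') ∈ RelColRef.stp Q.root.1 Q.root.1 → (i, i') ∈ x.stp := by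
  classical
  rcases x with a | b
  · exact mem_of_sum_count_ne_zero (fun _ => rfl) h
  · exact mem_of_sum_count_ne_zero (fun _ => rfl) h

open Classical in
/-- The similarity types of a tuple with the tuples of a given color. -/
noncomputable def similarityTypes {M : Type*} [L.Structure M] [Finite M] (i : ℕ) (k : Color L i)
    (a : Tuple L M) : Multiset (Set (ℕ × ℕ)) :=
  (Finset.univ.filter fun b : Tuple L M => color L i b = k).val.map fun b => stp a.1 b.1

open Classical in
theorem count_color_succ {M : Type*} [L.Structure M] [Finite M] (i : ℕ) (k : Color L i)
    (a : Tuple L M) (q : Set (ℕ × ℕ)) :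
    (color L (i + 1) a).2.count (q, k) =
      if q.Nonempty then (similarityTypes i k a).count q else 0 := by
  simp only [color, similarityTypes, Multiset.count_map, ← Finset.filter_val, Finset.card_val,
    Finset.filter_filter]
  split_ifs with hq
  · congr 1
    ext b
    simp only [Finset.mem_filter, Finset.mem_univ, true_and, Prod.mk.injEq]
    constructor
    · rintro ⟨_, h, h'⟩
      exact ⟨h'.symm, h⟩
    · rintro ⟨h, h'⟩
      exact ⟨h' ▸ hq, h', h.symm⟩
  · rw [Finset.card_eq_zero, Finset.filter_eq_empty_iff]
    rintro b - ⟨h, h'⟩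
    exact hq ((Prod.mk.inj h').1 ▸ h)

open Classical in
theorem sum_indicator_eq_countP {M : Type*} [L.Structure M] [Finite M] (i : ℕ) (k : Color L i)
    (a : Tuple L M) (q : Set (ℕ × ℕ)) :
    ∑ b : Tuple L M, (if q ⊆ stp a.1 b.1 then (if color L i b = k then (1 : ℚ) else 0) else 0) =
      ((similarityTypes i k a).countP (q ≤ ·) : ℕ) := by
  simp only [similarityTypes, Multiset.countP_map, ← Finset.filter_val, Finset.card_val,
    Finset.filter_filter, ← ite_and]
  rw [Finset.sum_boole]
  congr 2
  ext b
  simp only [Finset.mem_filter, Finset.mem_univ, true_and]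
  exact and_comm

/-- Both sides are linear in `f`, and on a generator they are the total homomorphism counts. -/
theorem sum_eq_of_mem_countSpan
    (h : ∀ P : RootedStructure L, homCount L P.carrier A = homCount L P.carrier B)
    {f : TwoTuple L A B → ℚ} (hf : f ∈ countSpan L A B) :
    ∑ a, f (.inl a) = ∑ b, f (.inr b) := by
  induction hf using Submodule.span_induction with
  | mem f hf =>
    obtain ⟨P, rfl⟩ := hf
    simp only [RootedStructure.vec, Sum.elim_inl, Sum.elim_inr, ← Nat.cast_sum,
      RootedStructure.sum_count, h P]
  | zero => simp
  | add f g _ _ hf hg => simp only [Pi.add_apply, Finset.sum_add_distrib, hf, hg]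
  | smul c f _ hf => simp only [Pi.smul_apply, ← Finset.smul_sum, hf]

variable [L.IsRelational]

theorem mul_mem_countSpan (hpos : IsEmpty (L.Relations 0)) {f g : TwoTuple L A B → ℚ}
    (hf : f ∈ countSpan L A B) (hg : g ∈ countSpan L A B) : f * g ∈ countSpan L A B := by
  induction hf, hg using Submodule.span_induction₂ with
  | mem_mem f g hf hg =>
    obtain ⟨P, rfl⟩ := hf
    obtain ⟨Q, rfl⟩ := hg
    by_cases h : Q.root.1.1 = P.root.1.1
    · convert vec_mem_countSpan (A := A) (B := B) (P.mul Q hpos h) using 1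
      funext x
      rcases x with a | b <;>
      simp [RootedStructure.vec, RootedStructure.count_mul]
    -- Roots of different arities have counting functions with disjoint supports, so the product is
    -- zero.
    · convert (countSpan L A B).zero_mem using 1
      funext x
      by_contra hx
      obtain ⟨h1, h2⟩ := mul_ne_zero_iff.1 hx
      exact h ((RootedStructure.arity_eq_of_vec h2).symm.trans (RootedStructure.arity_eq_of_vec h1))
  | zero_left g _ => rw [zero_mul]; exact Submodule.zero_mem _
  | zero_right f _ => rw [mul_zero]; exact Submodule.zero_mem _
  | add_left f g h _ _ _ hf hg => rw [add_mul]; exact Submodule.add_mem _ hf hg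
  | add_right f g h _ _ _ hf hg => rw [mul_add]; exact Submodule.add_mem _ hf hg
  | smul_left c f g _ _ h => rw [smul_mul_assoc]; exact Submodule.smul_mem _ _ h
  | smul_right c f g _ _ h => rw [mul_smul_comm]; exact Submodule.smul_mem _ _ h

/-- The sum itself need not be the counting function of a rooted structure, as there is no base to
attach to. Multiplied by the count of a single-tuple structure `P` with value 1 at both `x` and `y`,
it becomes one. -/
theorem Indistinguishable.sumAbove_eq {x y : TwoTuple L A B} (h : Indistinguishable x y)
    {p : Set (ℕ × ℕ)} (hp : p.Nonempty) {f : TwoTuple L A B → ℚ} (hf : f ∈ countSpan L A B) :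
    TwoTuple.sumAbove p f x = TwoTuple.sumAbove p f y := by
  induction hf using Submodule.span_induction with
  | zero =>
    have h0 : TwoTuple.sumAbove p (0 : TwoTuple L A B → ℚ) = 0 := by
      simpa using TwoTuple.sumAbove_smul p (0 : ℚ) (0 : TwoTuple L A B → ℚ)
    rw [h0]; rfl
  | add f g _ _ hf hg => rw [TwoTuple.sumAbove_add, Pi.add_apply, Pi.add_apply, hf, hg]
  | smul c f _ hf => rw [TwoTuple.sumAbove_smul, Pi.smul_apply, Pi.smul_apply, hf]
  | mem f hf =>
    obtain ⟨Q, rfl⟩ := hf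
    by_cases hx : (∀ i j, (i, j) ∈ p → j < Q.root.1.1) ∧ ∀ i i' j j', (i, j) ∈ p → (i', j') ∈ p →
      (j, j') ∈ stp Q.root.1 Q.root.1 → (i, i') ∈ x.stp
    · obtain ⟨hb, hcomp⟩ := hx
      obtain ⟨R, hR⟩ := x.atp_nonempty
      obtain ⟨P, -, hstp, hPx⟩ := TwoTuple.exists_vec_eq_one hR
      have hPy : P.vec y = 1 := (h _ (vec_mem_countSpan P)).symm.trans hPx
      have hcomp' : Compatible P.root.1 Q.root.1 p := by
        unfold Compatible
        rw [hstp]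
        exact hcomp
      have hbound : ∀ i j, (i, j) ∈ p → i < P.root.1.1 ∧ j < Q.root.1.1 := by
        intro i j hij
        have hj := hb i j hij
        -- Compatibility applied to the pair `(i, j)` twice gives `(i, i) ∈ stp P.root P.root`,
        -- which says that `i` is a position of the root.
        obtain ⟨hi, _⟩ := mem_stp_iff.1
          (hcomp' i i j j hij hij (mem_stp_iff.2 ⟨hj, hj, rfl⟩))
        exact ⟨hi, hj⟩
      have hne : ∃ x y, PositionRel P.root.1 Q.root.1 p x y := by
        obtain ⟨⟨i, j⟩, hij⟩ := hp
        exact ⟨_, _, ⟨i, (hbound i j hij).1⟩, ⟨j, (hbound i j hij).2⟩, hij, rfl, rfl⟩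
      have hvec : ∀ z : TwoTuple L A B,
          (P.attach Q p hcomp' hne).vec z = P.vec z * TwoTuple.sumAbove p Q.vec z := by
        intro z
        rcases z with a | b <;>
        simp [RootedStructure.vec, TwoTuple.sumAbove, RootedStructure.count_attach P Q p hcomp' hne hbound]
      have h1 := h _ (vec_mem_countSpan (P.attach Q p hcomp' hne))
      rwa [hvec, hvec, hPx, hPy, one_mul, one_mul] at h1
    -- If attaching is impossible, the sum vanishes at `x`, and also at `y` because `x.stp = y.stp`.
    · have hx0 : TwoTuple.sumAbove p Q.vec x = 0 := by
        by_contra h0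
        exact hx (TwoTuple.compatible_of_sumAbove_ne_zero h0)
      have hy0 : TwoTuple.sumAbove p Q.vec y = 0 := by
        by_contra h0
        exact hx (h.stp_eq ▸ TwoTuple.compatible_of_sumAbove_ne_zero h0)
      rw [hx0, hy0]

open Classical in
-- By `hi` a color class is a union of indistinguishability classes, and the single-tuple structures
-- ensure that the span vanishes at no point.
theorem indicator_color_mem (hpos : IsEmpty (L.Relations 0)) {i : ℕ}
    (hi : ∀ x y : TwoTuple L A B, Indistinguishable x y → x.color i = y.color i) (k : Color L i) :
    {x : TwoTuple L A B | x.color i = k}.indicator 1 ∈ countSpan L A B := by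
  refine indicator_mem (fun f hf g hg => mul_mem_countSpan hpos hf hg) (fun x => ?_) ?_
  · obtain ⟨R, hR⟩ := x.atp_nonempty
    obtain ⟨P, -, -, hP⟩ := TwoTuple.exists_vec_eq_one hR
    exact ⟨_, vec_mem_countSpan P, hP ▸ one_ne_zero⟩
  · intro x y hxy hx
    exact (hi x y hxy).symm.trans hx

open Classical in
/-- Tuples that are not separated by counts of rooted structures have the same colors. -/
theorem Indistinguishable.color_eq (hpos : IsEmpty (L.Relations 0)) (i : ℕ) :
    ∀ x y : TwoTuple L A B, Indistinguishable x y → x.color i = y.color i := by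
  induction i with
  | zero =>
    intro x y h
    have h1 : x.atp = y.atp := h.atp_subset.antisymm h.symm.atp_subset
    have h2 := h.stp_eq
    rcases x with a | b <;> rcases y with a' | b' <;> exact Prod.ext h1 h2
  | succ i ih =>
    intro x y h
    have hsum : ∀ q : Set (ℕ × ℕ), q.Nonempty → ∀ k,
        TwoTuple.sumAbove q ({x : TwoTuple L A B | x.color i = k}.indicator 1) x =
        TwoTuple.sumAbove q ({x : TwoTuple L A B | x.color i = k}.indicator 1) y :=
      fun q hq k => h.sumAbove_eq hq (indicator_color_mem hpos ih k)
    -- Only nonempty similarity types are under control, and only these enter the next color; they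
    -- form an upper set, so the inversion stays within them.
    have hup : IsUpperSet {q : Set (ℕ × ℕ) | q.Nonempty} := fun q q' hqq hq => hq.mono hqq
    have hxy := ih x y h
    rcases x with a | b <;> rcases y with a' | b' <;>
    · refine Prod.ext hxy (Multiset.ext.2 ?_)
      rintro ⟨q, k⟩
      refine (count_color_succ i k _ q).trans (Eq.trans ?_ (count_color_succ i k _ q).symm)
      split_ifs with hq
      · refine count_eq_of_countP_le_eq hup (fun q hq => ?_) q hq
        rw [← Nat.cast_inj (R := ℚ), ← sum_indicator_eq_countP, ← sum_indicator_eq_countP]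
        exact hsum q hq k
      · rfl

open Classical in
/-- Structures that Relational Color Refinement distinguishes are separated by the number of
homomorphisms from some rooted structure. -/
theorem exists_homCount_ne_of_distinguishes (hpos : IsEmpty (L.Relations 0))
    (h : Distinguishes L A B) :
    ∃ P : RootedStructure L, homCount L P.carrier A ≠ homCount L P.carrier B := by
  by_contra! hP
  obtain ⟨i, k, -, hne⟩ := h
  have h1 := sum_eq_of_mem_countSpan hP
    (indicator_color_mem hpos (Indistinguishable.color_eq (A := A) (B := B) hpos i) k)
  apply hne
  rw [colorCount, colorCount, Nat.card_eq_fintype_card, Nat.card_eq_fintype_card,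
    Fintype.card_subtype, Fintype.card_subtype, ← Nat.cast_inj (R := ℚ), ← Finset.sum_boole,
    ← Finset.sum_boole]
  exact h1

end Span

end RelColRef

/-! ### The equivalence -/

theorem theoremA (L : FirstOrder.Language.{u, v}) [L.IsRelational]
    [Finite (Σ n : ℕ, L.Relations n)] (hne : Nonempty (Σ n : ℕ, L.Relations n))
    (hpos : IsEmpty (L.Relations 0))
    (A : Type w) (B : Type w') [L.Structure A] [L.Structure B]
    [Finite A] [Nonempty A] (hA : RelColRef.EveryElementOccurs L A)
    [Finite B] [Nonempty B] (hB : RelColRef.EveryElementOccurs L B) :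
    RelColRef.Distinguishes L A B ↔
      ∃ (C : Type) (_ : L.Structure C),
        Finite C ∧ Nonempty C ∧ RelColRef.EveryElementOccurs L C ∧
          RelColRef.IsAcyclic L C ∧ RelColRef.IsConnected L C ∧
          RelColRef.homCount L C A ≠ RelColRef.homCount L C B := by
  constructor
  · intro h
    obtain ⟨P, hP⟩ := RelColRef.exists_homCount_ne_of_distinguishes hpos h
    have hconn := P.acyclic.isConnected hpos P.occurs
    exact ⟨P.carrier, P.str, P.finite, hconn.nonempty, P.occurs, P.acyclic.isAcyclic P.occurs,
      hconn, hP⟩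
  · rintro ⟨C, _, _, _, hC, hacyc, hconn, hne⟩
    by_contra h
    exact hne (RelColRef.homCount_eq_of_not_distinguishes hpos h hC hacyc hconn)
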